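/- **Setting.** Let $d\ge 1$, $\|v\|=\sum_i|v_i|$ on $\mathbb R^d$, $\mathbb S_+=\{x\in\mathbb R^d: x_i\ge 0\ \forall i,\ \|x\|=1\}$, and let $\mathbb M$ be the semigroup of $d\times d$ matrices with nonnegative entries that have a strictly positive entry in every row and every column. For $g\in\mathbb M$, $x\in\mathbb S_+$ put $g\cdot x=gx/\|gx\|$, $\sigma(g,x)=\log\|gx\|$, and $\|g\|=\sup_{v\ge0,\,v\ne0}\|gv\|/\|v\|$. Let $\mathscr N=\sum_{j=1}^N\delta_{g_j}$ be a point process on $\mathbb M$ (with measurably enumerated points, $0\le N\le\infty$), with law $\eta$ and intensity measure $\mu$. Attach i.i.d. copies $\mathscr N_u=\sum_{j\le N_u}\delta_{g_{uj}}$ of $\mathscr N$ to the nodes $u$ of the Ulam–Harris tree, let $\mathbb T$ be the resulting random tree (the children of $u\in\mathbb T$ are $uj$, $1\le j\le N_u$), $G_u=g_u g_{u|n-1}\cdots g_{u|1}$ for $|u|=n$, and, given $(X_\varnothing,S_\varnothing)$, let $X_u=G_u\cdot X_\varnothing$, $S_u=S_\varnothing-\sigma(G_u,X_\varnothing)$.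 Under $\mathbb P_{x,b}$ one has $(X_\varnothing,S_\varnothing)=(x,b)$. Let $\mathscr F_n=\sigma(X_\varnothing,S_\varnothing,\{u,g_u:u\in\mathbb T,|u|\le n\})$ and $\mathscr F_\infty=\sigma(\bigcup_n\mathscr F_n)$. **Assumptions.** Let $\Gamma$ be the smallest closed subsemigroup of $\mathbb M$ that contains all points of $\mathscr N$ almost surely; assume that $\Gamma$ contains a matrix with strictly positive entries and that $\mathbb E N>1$. Let $I=\{s\ge0:\int\|g\|^s\mu(dg)<\infty\}$, and for $s\in I$ let $P_s\varphi(x)=\int e^{s\sigma(g,x)}\varphi(g\cdot x)\,\mu(dg)$ on the continuous functions on $\mathbb S_+$. Assume that $\alpha$ is an interior point of $I$, that the dominant eigenvalue $\mathfrak m(\alpha)$ of $P_\alpha$ equals $1$, and let $r_\alpha$ be the corresponding strictly positive continuous eigenfunction, $P_\alpha r_\alpha=r_\alpha$. **The Markov random walk.** $\mathbb Q^\alpha_{x,b}$ is the law of $(X_0,S_0,(g_i)_{i\ge1})$ for which $(X_0,S_0)=(x,b)$ and, given $g_1,\dots,g_n$, the matrix $g_{n+1}$ has law $\frac{\|gX_n\|^\alpha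 r_\alpha(g\cdot X_n)}{r_\alpha(X_n)}\mu(dg)$, where $X_n=(g_n\cdots g_1)\cdot X_0$ and $S_n=S_0-\log\|g_n\cdots g_1X_0\|$. Equivalently (this is part of the claim), for all $n$ and measurable $f\ge0$, $$\mathbb E_{\mathbb Q^\alpha_{x,b}}f(g_1,\dots,g_n)=\frac{e^{\alpha b}}{r_\alpha(x)}\,\mathbb E_{x,b}\Big[\sum_{|u|=n}e^{-\alpha S_u}r_\alpha(X_u)f(g_{u|1},\dots,g_{u|n})\Big].$$ **The size-biased law.** Let $B\subseteq\mathbb R$ be measurable and let $h$ be measurable, strictly positive on $\mathbb S_+\times B$, with $\mathbb E_{\mathbb Q^\alpha_{x,b}}[h(X_1,S_1)\mathbf 1_{\{S_1\in B\}}]=h(x,b)$ for all $x\in\mathbb S_+$, $b\in B$. Put $H_\alpha(y,s)=r_\alpha(y)h(y,s)e^{-\alpha s}$ and $$M_n^h=\sum_{|u|=n}H_\alpha(X_u,S_u)\mathbf 1_{\{S_{u|k}\in B,\ 0\le k\le n\}}.$$ For $x\in\mathbb S_+$, $b\in B$, let $\widehat{\mathbb P}_{x,b}$ be the probability measure on $\mathscr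 F_\infty$ with $\widehat{\mathbb P}_{x,b}(A)=\mathbb E_{x,b}[M_n^h\mathbf 1_A]/H_\alpha(x,b)$ for $A\in\mathscr F_n$, $n\ge0$, extended so as to carry a random sequence of labels $w$ (the spine) with $$\widehat{\mathbb P}_{x,b}(w|n=z\mid\mathscr F_n)=\frac{H_\alpha(X_z,S_z)\,\mathbf 1_{\{z\in\mathbb T,\ S_{z|k}\in B,\ 0\le k\le n\}}}{M_n^h}\quad\text{a.s., for all }n\ge0,\ |z|=n. \tag{1}$$ **The process with a spine.** Let $\widetilde{\mathbb P}_{x,b}$ be the law of the following process. The root, at $(x,b)$, is the first spine particle. A spine particle at $p=(y,s)$ has offspring with the law that has density $\frac1{H_\alpha(p)}\sum_{j\le N}H_\alpha(p_j)\mathbf 1_{\{s_j\in B\}}$ with respect to $\eta$, where $p_j=(g_j\cdot y,s_j)$ and $s_j=s-\sigma(g_j,y)$; given its offspring, child $j$ is chosen as the next spine particle with probability proportional to $H_\alpha(p_j)\mathbf 1_{\{s_j\in B\}}$. All other particles reproduce independently according to $\eta$. The labels of the chosen children form $w$. **Theorem (spinal decomposition).** Let $x\in\mathbb S_+$ and $b\in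 B$. (a) $\widehat{\mathbb P}_{x,b}$ and its extension to $\sigma(\mathscr F_\infty,w)$ exist and are unique, and the extension is equal to $\widetilde{\mathbb P}_{x,b}$ on $\sigma(\mathscr F_\infty,w)$. In particular $\widetilde{\mathbb P}_{x,b}=\widehat{\mathbb P}_{x,b}$ on $\mathscr F_\infty$, and (1) holds under $\widetilde{\mathbb P}_{x,b}$. (b) For every $n\ge0$ and measurable $f\ge0$, $$\widehat{\mathbb E}_{x,b}\Big[f\big((X_{w|k},S_{w|k})_{0\le k\le n}\big)\Big]=\mathbb E_{\mathbb Q^\alpha_{x,b}}\Big[f\big((X_k,S_k)_{0\le k\le n}\big)\frac{h(X_n,S_n)}{h(x,b)}\mathbf 1_{\{S_k\in B,\ 0\le k\le n\}}\Big].$$ (c) If $B=\mathbb R$ and $h\equiv1$ then, for all $x\in\mathbb S_+$ and $b\in\mathbb R$, the assertions of (a) hold and the process $(X_{w|n},S_{w|n})_{n\ge0}$ under $\widehat{\mathbb P}_{x,b}$ has the same law as $(X_n,S_n)_{n\ge0}$ under $\mathbb Q^\alpha_{x,b}$. -/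

import Mathlib

open MeasureTheory ProbabilityTheory
open scoped ENNReal Matrix

namespace MatrixBRW

noncomputable section

/-! ## Nonnegative matrices and their action on the simplex -/

/-- The `ℓ¹` norm on `ℝ^d`. -/
def l1norm {d : ℕ} (v : Fin d → ℝ) : ℝ := ∑ i, |v i|

/-- A matrix with nonnegative entries is allowable if every row and every column has a
strictly positive entry. -/
def Allowable {d : ℕ} (g : Matrix (Fin d) (Fin d) ℝ) : Prop :=
  (∀ i j, 0 ≤ g i j) ∧ (∀ i, ∃ j, 0 < g i j) ∧ (∀ j, ∃ i, 0 < g i j)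

/-- The semigroup `𝕄` of allowable `d × d` matrices (it contains the identity). -/
def allowableSubmonoid (d : ℕ) : Submonoid (Matrix (Fin d) (Fin d) ℝ) where
  carrier := {g | Allowable g}
  one_mem' := by
    refine ⟨fun i j => ?_, fun i => ⟨i, by simp⟩, fun j => ⟨j, by simp⟩⟩
    by_cases h : i = j <;> simp [Matrix.one_apply, h]
  mul_mem' := by
    rintro a b ⟨ha, har, hac⟩ ⟨hb, hbr, hbc⟩
    refine ⟨fun i j => ?_, fun i => ?_, fun j => ?_⟩
    · rw [Matrix.mul_apply]
      exact Finset.sum_nonneg fun k _ => mul_nonneg (ha i k) (hb k j)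
    · obtain ⟨k, hk⟩ := har i
      obtain ⟨j, hj⟩ := hbr k
      exact ⟨j, Finset.sum_pos' (fun l _ => mul_nonneg (ha i l) (hb l j))
        ⟨k, Finset.mem_univ _, mul_pos hk hj⟩⟩
    · obtain ⟨k, hk⟩ := hbc j
      obtain ⟨i, hi⟩ := hac k
      exact ⟨i, Finset.sum_pos' (fun l _ => mul_nonneg (ha i l) (hb l j))
        ⟨k, Finset.mem_univ _, mul_pos hi hk⟩⟩

/-- The type of allowable matrices, with the multiplication and the topology inherited from
matrices. -/
abbrev Mat (d : ℕ) : Type := allowableSubmonoid d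

/-- The Borel `σ`-algebra of `ℝ^{d × d}`. -/
instance instMeasurableSpaceMatrix (d : ℕ) : MeasurableSpace (Matrix (Fin d) (Fin d) ℝ) :=
  inferInstanceAs (MeasurableSpace (Fin d → Fin d → ℝ))

/-- The set `𝕊₊^{d-1}` of nonnegative vectors of `ℓ¹` norm one. -/
abbrev Sph (d : ℕ) : Type := {x : Fin d → ℝ // (∀ i, 0 ≤ x i) ∧ l1norm x = 1}

theorem l1norm_nonneg {d : ℕ} (v : Fin d → ℝ) : 0 ≤ l1norm v :=
  Finset.sum_nonneg fun _ _ => abs_nonneg _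

theorem mulVec_nonneg {d : ℕ} (g : Mat d) (x : Sph d) (i : Fin d) : 0 ≤ (g.1 *ᵥ x.1) i := by
  rw [Matrix.mulVec, dotProduct]
  exact Finset.sum_nonneg fun j _ => mul_nonneg (g.2.1 i j) (x.2.1 j)

theorem l1norm_mulVec_pos {d : ℕ} (g : Mat d) (x : Sph d) : 0 < l1norm (g.1 *ᵥ x.1) := by
  have hx : ∃ j, 0 < x.1 j := by
    by_contra! hcon
    have h0 : l1norm x.1 = 0 := Finset.sum_eq_zero fun i _ => by
      rw [le_antisymm (hcon i) (x.2.1 i), abs_zero]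
    rw [x.2.2] at h0
    exact one_ne_zero h0
  obtain ⟨j, hj⟩ := hx
  obtain ⟨i, hi⟩ := g.2.2.2 j
  refine Finset.sum_pos' (fun _ _ => abs_nonneg _) ⟨i, Finset.mem_univ _, ?_⟩
  refine abs_pos.2 (ne_of_gt ?_)
  exact Finset.sum_pos' (fun l _ => mul_nonneg (g.2.1 i l) (x.2.1 l))
    ⟨j, Finset.mem_univ _, mul_pos hi hj⟩

/-- The projective action `g · x = g x / ‖g x‖`. -/
def dot {d : ℕ} (g : Mat d) (x : Sph d) : Sph d :=
  ⟨fun i => (g.1 *ᵥ x.1) i / l1norm (g.1 *ᵥ x.1),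
    fun i => div_nonneg (mulVec_nonneg g x i) (l1norm_nonneg _), by
      have hp := l1norm_mulVec_pos g x
      have : ∀ i, |(g.1 *ᵥ x.1) i / l1norm (g.1 *ᵥ x.1)|
          = |(g.1 *ᵥ x.1) i| / l1norm (g.1 *ᵥ x.1) := fun i => by
        rw [abs_div, abs_of_pos hp]
      unfold l1norm at *
      simp only [this]
      rw [← Finset.sum_div]
      exact div_self hp.ne'⟩

/-- The cocycle `σ(g, x) = log ‖g x‖`. -/
def cocycle {d : ℕ} (g : Mat d) (x : Sph d) : ℝ := Real.log (l1norm (g.1 *ᵥ x.1))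

/-- `‖g‖ = sup ‖g v‖ / ‖v‖` over nonzero nonnegative vectors `v`. -/
def opNorm {d : ℕ} (g : Mat d) : ℝ :=
  ⨆ v : {v : Fin d → ℝ // (∀ i, 0 ≤ v i) ∧ v ≠ 0}, l1norm (g.1 *ᵥ v.1) / l1norm v.1

/-- One step of the walk: from direction `x` and position `b`, the matrix `g` leads to
`(g · x, b - σ(g, x))`. -/
def step {d : ℕ} (p : Sph d × ℝ) (g : Mat d) : Sph d × ℝ := (dot g p.1, p.2 - cocycle g p.1)

theorem measurable_mulVec {d : ℕ} (i : Fin d) :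
    Measurable fun q : (Sph d × ℝ) × Mat d => (q.2.1 *ᵥ q.1.1.1) i := by
  have hg : ∀ j, Measurable fun q : (Sph d × ℝ) × Mat d => q.2.1 i j := fun j =>
    (measurable_pi_apply j).comp ((measurable_pi_apply i).comp
      (measurable_subtype_coe.comp measurable_snd))
  have hx : ∀ j, Measurable fun q : (Sph d × ℝ) × Mat d => q.1.1.1 j := fun j =>
    (measurable_pi_apply j).comp (measurable_subtype_coe.comp
      (measurable_fst.comp measurable_fst))
  exact Finset.measurable_fun_sum Finset.univ fun j _ => (hg j).mul (hx j)

theorem measurable_step {d : ℕ} :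
    Measurable fun q : (Sph d × ℝ) × Mat d => step q.1 q.2 := by
  have hl : Measurable fun q : (Sph d × ℝ) × Mat d => l1norm (q.2.1 *ᵥ q.1.1.1) :=
    Finset.measurable_fun_sum Finset.univ fun i _ => (measurable_mulVec i).abs
  refine Measurable.prodMk ?_ ?_
  · exact Measurable.subtype_mk (measurable_pi_lambda _ fun i => (measurable_mulVec i).div hl)
  · exact (measurable_snd.comp measurable_fst).sub (Real.measurable_log.comp hl)

/-! ## Point processes -/

/-- A realization of a point process on `𝕄` with enumerated points: the number `N` of points
(possibly infinite) and a sequence of matrices. Only the matrices with index `j < N` are points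
(children are labelled from `0`); the other entries of the sequence are irrelevant. The law of
the point process is a probability measure on this type. -/
abbrev Config (d : ℕ) : Type := ℕ∞ × (ℕ → Mat d)

/-- The counting measure `∑_{j < N} δ_{g_j}`. -/
def pointMeasure {d : ℕ} (c : Config d) : Measure (Mat d) :=
  Measure.sum fun j : {j : ℕ // (j : ℕ∞) < c.1} => Measure.dirac (c.2 j)

/-- The intensity measure `μ` of the point process with law `η`. -/
def intensity {d : ℕ} (η : Measure (Config d)) : Measure (Mat d) :=
  Measure.sum fun j : ℕ =>
    (η.restrict {c | (j : ℕ∞) < c.1}).map fun c => c.2 j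

instance {d : ℕ} (η : Measure (Config d)) [SFinite η] : SFinite (intensity η) := by
  unfold intensity; infer_instance

/-- `μ(A) = 𝔼[𝒩(A)]`. -/
theorem intensity_apply {d : ℕ} (η : Measure (Config d)) {A : Set (Mat d)}
    (hA : MeasurableSet A) : intensity η A = ∫⁻ c, pointMeasure c A ∂η := by
  classical
  have hc : ∀ j : ℕ, MeasurableSet {c : Config d | (j : ℕ∞) < c.1} := fun j =>
    measurable_fst (MeasurableSet.of_discrete (s := {n : ℕ∞ | (j : ℕ∞) < n}))
  have hg : ∀ j : ℕ, Measurable fun c : Config d => c.2 j := fun j =>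
    (measurable_pi_apply j).comp measurable_snd
  have h1 : ∀ c : Config d, pointMeasure c A
      = ∑' j : ℕ, ({c : Config d | (j : ℕ∞) < c.1} ∩ {c | c.2 j ∈ A}).indicator 1 c := by
    intro c
    rw [pointMeasure, Measure.sum_apply _ hA]
    have := tsum_subtype {j : ℕ | (j : ℕ∞) < c.1} (fun j => Measure.dirac (c.2 j) A)
    refine this.trans (tsum_congr fun j => ?_)
    by_cases h : (j : ℕ∞) < c.1 <;> by_cases h' : c.2 j ∈ A <;>
      simp [Set.indicator, h, h', hA]
  simp only [h1]
  rw [lintegral_tsum, intensity, Measure.sum_apply _ hA]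
  · refine tsum_congr fun j => ?_
    have h2 := lintegral_indicator_one (μ := η) ((hc j).inter (hg j hA))
    rw [Measure.map_apply (hg j) hA, Measure.restrict_apply (hg j hA), Set.inter_comm, ← h2]
    rfl
  · exact fun j => (measurable_one.indicator ((hc j).inter (hg j hA))).aemeasurable

/-- `Γ`: the smallest closed subsemigroup of the semigroup of allowable matrices that contains
all points of the process almost surely. -/
def semigroupΓ {d : ℕ} (η : Measure (Config d)) : Subsemigroup (Mat d) :=
  sInf {K | IsClosed (K : Set (Mat d)) ∧ ∀ᵐ c ∂η, ∀ j : ℕ, (j : ℕ∞) < c.1 → c.2 j ∈ K}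

/-- `I = {s ≥ 0 : 𝔼 ∑_{|u|=1} ‖G_u‖^s < ∞}`. -/
def momentSet {d : ℕ} (η : Measure (Config d)) : Set ℝ :=
  {s | 0 ≤ s ∧ ∫⁻ g, ENNReal.ofReal (opNorm g ^ s) ∂(intensity η) < ∞}

/-- The transfer operator `P_s φ(x) = ∫ e^{s σ(g,x)} φ(g · x) μ(dg)`. -/
def transferOp {d : ℕ} (η : Measure (Config d)) (s : ℝ) {E : Type*} [NormedAddCommGroup E]
    [NormedSpace ℝ E] (φ : Sph d → E) (x : Sph d) : E :=
  ∫ g, Real.exp (s * cocycle g x) • φ (dot g x) ∂(intensity η)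

/-- `z` is an eigenvalue of `P_s` acting on the continuous complex functions on `𝕊₊^{d-1}`. -/
def IsEigenvalue {d : ℕ} (η : Measure (Config d)) (s : ℝ) (z : ℂ) : Prop :=
  ∃ φ : C(Sph d, ℂ), φ ≠ 0 ∧ ∀ x, transferOp η s φ x = z * φ x

/-- `𝔪(s) = m`: the number `m > 0` is the dominant eigenvalue of `P_s`, all other eigenvalues
being strictly smaller in absolute value. -/
def IsDominantEigenvalue {d : ℕ} (η : Measure (Config d)) (s m : ℝ) : Prop :=
  0 < m ∧ IsEigenvalue η s m ∧ ∀ z : ℂ, IsEigenvalue η s z → z ≠ m → ‖z‖ < m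

/-! ## The branching random walk -/

/-- An environment: one point configuration for each node of the Ulam-Harris tree, whose nodes
are the finite words over `ℕ`, with the empty word as root. -/
abbrev Env (d : ℕ) : Type := List ℕ → Config d

/-- The space `Ω⁽¹⁾`: an environment, an initial direction and an initial position. -/
abbrev Omega1 (d : ℕ) : Type := Env d × (Sph d × ℝ)

/-- The space `Ω⁽²⁾ = Ω⁽¹⁾ × ℕ^ℕ`, which also carries the spine. -/
abbrev Omega2 (d : ℕ) : Type := Omega1 d × (ℕ → ℕ)

/-- `ℙ_{x,b}`: the configurations are i.i.d. with law `η`, and `(X_∅, S_∅) = (x, b)`. -/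
def lawP {d : ℕ} (η : Measure (Config d)) (x : Sph d) (b : ℝ) : Measure (Omega1 d) :=
  (Measure.infinitePi fun _ : List ℕ => η).prod (Measure.dirac (x, b))

/-- `u ∈ 𝕋`: every letter of `u` is the label of an existing child of the preceding node. -/
def InTree {d : ℕ} (ω : Env d) (u : List ℕ) : Prop :=
  ∀ (k : ℕ) (hk : k < u.length), ((u[k] : ℕ) : ℕ∞) < (ω (u.take k)).1

/-- The matrix `g_u` attached to the node `u`; `g_∅` is the identity. -/
def gMat {d : ℕ} (ω : Env d) (u : List ℕ) : Mat d :=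
  if u = [] then 1 else (ω u.dropLast).2 (u.getLastD 0)

/-- The product `g_{u|k} ⋯ g_{u|1}`. -/
def branchProd {d : ℕ} (ω : Env d) (u : List ℕ) : ℕ → Mat d
  | 0 => 1
  | k + 1 => gMat ω (u.take (k + 1)) * branchProd ω u k

/-- `G_u = g_u g_{u|n-1} ⋯ g_{u|1}` for `|u| = n`. -/
def G {d : ℕ} (ω : Env d) (u : List ℕ) : Mat d := branchProd ω u u.length

/-- `X_u = G_u · X_∅`. -/
def X {d : ℕ} (ω : Omega1 d) (u : List ℕ) : Sph d := dot (G ω.1 u) ω.2.1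

/-- `S_u = S_∅ - σ(G_u, X_∅)`. -/
def S {d : ℕ} (ω : Omega1 d) (u : List ℕ) : ℝ := ω.2.2 - cocycle (G ω.1 u) ω.2.1

open Classical in
/-- `ℱ_n = σ(X_∅, S_∅, {u, g_u : u ∈ 𝕋, |u| ≤ n})`. -/
@[reducible] def filtF (d : ℕ) (n : ℕ) : MeasurableSpace (Omega1 d) :=
  MeasurableSpace.comap Prod.snd inferInstance ⊔
    ⨆ (u : List ℕ) (_ : u.length ≤ n),
      MeasurableSpace.generateFrom {{ω : Omega1 d | InTree ω.1 u}} ⊔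
        MeasurableSpace.comap
          (fun ω : Omega1 d => if InTree ω.1 u then gMat ω.1 u else 1) inferInstance

/-- `ℱ_∞ = σ(⋃_n ℱ_n)`. -/
@[reducible] def filtFinf (d : ℕ) : MeasurableSpace (Omega1 d) := ⨆ n, filtF d n

/-- The first `n` letters `w|n` of a spine `w`. -/
def spineTake (w : ℕ → ℕ) (n : ℕ) : List ℕ := (List.range n).map w

/-- `σ(ℱ_∞, w)`, a `σ`-algebra on `Ω⁽²⁾`. -/
@[reducible] def filtSpineInf (d : ℕ) : MeasurableSpace (Omega2 d) :=
  (filtFinf d).comap Prod.fst ⊔ MeasurableSpace.comap Prod.snd inferInstance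

/-! ## The size-biased law -/

/-- `H_α(y, s) = r_α(y) h(y, s) e^{-α s}`. -/
def Halpha {d : ℕ} (α : ℝ) (r : Sph d → ℝ) (h : Sph d × ℝ → ℝ) (p : Sph d × ℝ) : ℝ :=
  r p.1 * h p * Real.exp (-α * p.2)

open Classical in
/-- `H(X_u, S_u) 1{S_{u|k} ∈ B for all 0 ≤ k ≤ |u|}` if `u ∈ 𝕋`, and `0` if `u ∉ 𝕋`. -/
def nodeTerm {d : ℕ} (H : Sph d × ℝ → ℝ) (B : Set ℝ) (ω : Omega1 d) (u : List ℕ) : ℝ≥0∞ :=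
  if InTree ω.1 u ∧ ∀ k ≤ u.length, S ω (u.take k) ∈ B then ENNReal.ofReal (H (X ω u, S ω u))
  else 0

/-- The truncated martingale `M_n = ∑_{|u|=n} H(X_u, S_u) 1{S_{u|k} ∈ B, ∀ 0 ≤ k ≤ n}`. -/
def martM {d : ℕ} (H : Sph d × ℝ → ℝ) (B : Set ℝ) (n : ℕ) (ω : Omega1 d) : ℝ≥0∞ :=
  ∑' u : {u : List ℕ // u.length = n}, nodeTerm H B ω u

/-- `Phat` is a version of `ℙ̂_{x,b}`: a probability measure on `Ω⁽¹⁾` with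
`ℙ̂(A) = 𝔼_{x,b}[M_n 1_A] / H(x,b)` for all `A ∈ ℱ_n` and all `n`. -/
def IsSizeBiased {d : ℕ} (η : Measure (Config d)) (H : Sph d × ℝ → ℝ) (B : Set ℝ)
    (x : Sph d) (b : ℝ) (Phat : Measure (Omega1 d)) : Prop :=
  IsProbabilityMeasure Phat ∧
    ∀ (n : ℕ) (A : Set (Omega1 d)), MeasurableSet[filtF d n] A →
      Phat A = (∫⁻ ω in A, martM H B n ω ∂(lawP η x b)) / ENNReal.ofReal (H (x, b))

/-- `Phat` is a version of `ℙ̂_{x,b}` extended to `Ω⁽²⁾` so as to carry the spine `w`: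
its first marginal is `ℙ̂_{x,b}`, and
`ℙ̂(w|n = z | ℱ_n) = H(X_z, S_z) 1{z ∈ 𝕋, S_{z|k} ∈ B, ∀ 0 ≤ k ≤ n} / M_n` almost surely
whenever `|z| = n`. -/
def IsSizeBiasedWithSpine {d : ℕ} (η : Measure (Config d)) (H : Sph d × ℝ → ℝ) (B : Set ℝ)
    (x : Sph d) (b : ℝ) (Phat : Measure (Omega2 d)) : Prop :=
  IsProbabilityMeasure Phat ∧
    IsSizeBiased η H B x b (Phat.map Prod.fst) ∧
    ∀ (n : ℕ) (z : List ℕ), z.length = n →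
      Phat⟦{ω | spineTake ω.2 n = z} | (filtF d n).comap Prod.fst⟧
        =ᵐ[Phat] fun ω => (nodeTerm H B ω.1 z / martM H B n ω.1).toReal

/-! ## Markov chains with given transition densities -/

theorem measurableSet_massOne {Act Obs : Type*} [MeasurableSpace Act] [MeasurableSpace Obs]
    (ν : Measure Obs) [SFinite ν] (f : Act → Obs → ℝ≥0∞) (hf : Measurable (Function.uncurry f)) :
    MeasurableSet {a | ∫⁻ y, f a y ∂ν = 1} :=
  hf.lintegral_prod_right (measurableSet_singleton 1)

open Classical in
/-- The kernel `a ↦ f(a, ·) ν` at those `a` for which this is a probability measure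
(elsewhere, the constant `ν₀`, so as to have a Markov kernel in all cases). -/
def densityKernel {Act Obs : Type*} [MeasurableSpace Act] [MeasurableSpace Obs] (ν : Measure Obs)
    [SFinite ν] (f : Act → Obs → ℝ≥0∞) (ν₀ : Measure Obs) : Kernel Act Obs :=
  if hf : Measurable (Function.uncurry f) then
    Kernel.piecewise (measurableSet_massOne ν f hf)
      (Kernel.withDensity (Kernel.const Act ν) f) (Kernel.const Act ν₀)
  else Kernel.const Act ν₀

instance {Act Obs : Type*} [MeasurableSpace Act] [MeasurableSpace Obs] (ν : Measure Obs)
    [SFinite ν] (f : Act → Obs → ℝ≥0∞) (ν₀ : Measure Obs) [IsProbabilityMeasure ν₀] :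
    IsMarkovKernel (densityKernel ν f ν₀) := by
  classical
  unfold densityKernel
  split_ifs with hf
  · refine ⟨fun a => ⟨?_⟩⟩
    rw [Kernel.piecewise_apply]
    split_ifs with ha
    · rw [Kernel.withDensity_apply _ hf, withDensity_apply _ MeasurableSet.univ,
        Measure.restrict_univ, Kernel.const_apply]
      exact ha
    · simp
  · infer_instance

/-- A sequence of positions and moves: in position `p` a move `a` is drawn from `κ p`, and then
the new position is `next (p, a)`. This is the law of `(p_k, a_k)_{k ≥ 0}` started from
`p_0 = p₀`. -/
def moveChain {Pos Act : Type*} [MeasurableSpace Pos] [MeasurableSpace Act] (κ : Kernel Pos Act)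
    [IsMarkovKernel κ] (next : Pos × Act → Pos) (hnext : Measurable next) (p₀ : Pos) :
    Measure (ℕ → Pos × Act) :=
  Kernel.trajMeasure (X := fun _ => Pos × Act) ((Measure.dirac p₀) ⊗ₘ κ) fun n =>
    ((Kernel.deterministic next hnext) ⊗ₖ (κ.comap Prod.snd measurable_snd)).comap
      (fun y : (i : Finset.Iic n) → Pos × Act => y ⟨n, Finset.mem_Iic.2 le_rfl⟩)
      (measurable_pi_apply _)

/-! ## The Markov random walk under `ℚ_{x,b}^α` -/

/-- The transition kernel `‖g x‖^α r_α(g · x) / r_α(x) μ(dg)`. -/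
def walkKernel {d : ℕ} (η : Measure (Config d)) [SFinite η] (α : ℝ) (r : Sph d → ℝ) :
    Kernel (Sph d × ℝ) (Mat d) :=
  densityKernel (intensity η)
    (fun p g => ENNReal.ofReal (Real.exp (α * cocycle g p.1) * r (dot g p.1) / r p.1))
    (Measure.dirac 1)

instance {d : ℕ} (η : Measure (Config d)) [SFinite η] (α : ℝ) (r : Sph d → ℝ) :
    IsMarkovKernel (walkKernel η α r) := by
  unfold walkKernel; infer_instance

/-- The law `ℚ_{x,b}^α` of `(X_0, S_0, (g_i)_{i ≥ 1})`; the matrix `g_{i+1}` is stored at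
index `i`. -/
def lawQ {d : ℕ} (η : Measure (Config d)) [SFinite η] (α : ℝ) (r : Sph d → ℝ)
    (x : Sph d) (b : ℝ) : Measure ((Sph d × ℝ) × (ℕ → Mat d)) :=
  (moveChain (walkKernel η α r) (fun q => step q.1 q.2) measurable_step (x, b)).map
    fun y => ((x, b), fun k => (y k).2)

/-- The product `g_n ⋯ g_1`. -/
def walkProd {d : ℕ} (g : ℕ → Mat d) : ℕ → Mat d
  | 0 => 1
  | k + 1 => g k * walkProd g k

/-- `(X_n, S_n) = ((g_n ⋯ g_1) · X_0, S_0 - log ‖g_n ⋯ g_1 X_0‖)`. -/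
def walk {d : ℕ} (q : (Sph d × ℝ) × (ℕ → Mat d)) (n : ℕ) : Sph d × ℝ :=
  (dot (walkProd q.2 n) q.1.1, q.1.2 - cocycle (walkProd q.2 n) q.1.1)

/-- `h` is a positive harmonic function for the walk killed outside `𝕊₊^{d-1} × B`. -/
def IsPositiveHarmonic {d : ℕ} (η : Measure (Config d)) [SFinite η] (α : ℝ) (r : Sph d → ℝ)
    (B : Set ℝ) (h : Sph d × ℝ → ℝ) : Prop :=
  Measurable h ∧ ∀ (x : Sph d), ∀ b ∈ B, 0 < h (x, b) ∧
    ∫⁻ q in {q | (walk q 1).2 ∈ B}, ENNReal.ofReal (h (walk q 1)) ∂(lawQ η α r x b)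
      = ENNReal.ofReal (h (x, b))

/-! ## The branching process with a spine -/

open Classical in
/-- `H(y, s) 1{s ∈ B}` at the position `(y, s)` of the `j`-th child of a particle at `p` with
offspring configuration `c`, and `0` if there is no `j`-th child. -/
def childWeight {d : ℕ} (H : Sph d × ℝ → ℝ) (B : Set ℝ) (p : Sph d × ℝ) (c : Config d)
    (j : ℕ) : ℝ≥0∞ :=
  if (j : ℕ∞) < c.1 ∧ (step p (c.2 j)).2 ∈ B then ENNReal.ofReal (H (step p (c.2 j))) else 0

/-- The total weight of the children. -/
def totalWeight {d : ℕ} (H : Sph d × ℝ → ℝ) (B : Set ℝ) (p : Sph d × ℝ) (c : Config d) : ℝ≥0∞ :=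
  ∑' j, childWeight H B p c j

/-- The size-biased point process: in position `p`, the law of the offspring configuration has
density `∑_j H(X_j, S_j) 1{S_j ∈ B} / H(p)` with respect to the original law `η`. -/
def sizeBiasedOffspring {d : ℕ} (η : Measure (Config d)) [SFinite η] (H : Sph d × ℝ → ℝ)
    (B : Set ℝ) : Kernel (Sph d × ℝ) (Config d) :=
  densityKernel η (fun p c => totalWeight H B p c / ENNReal.ofReal (H p)) η

/-- The choice of the next spine particle among the children, with probabilities proportional to
their weights. -/
def spineChoice {d : ℕ} (H : Sph d × ℝ → ℝ) (B : Set ℝ) :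
    Kernel ((Sph d × ℝ) × Config d) ℕ :=
  densityKernel Measure.count
    (fun q j => childWeight H B q.1 q.2 j / totalWeight H B q.1 q.2) (Measure.dirac 0)

/-- The joint law of the offspring of a spine particle at `p` and of the label of the child that
continues the spine. -/
def spineKernel {d : ℕ} (η : Measure (Config d)) [SFinite η] (H : Sph d × ℝ → ℝ)
    (B : Set ℝ) : Kernel (Sph d × ℝ) (Config d × ℕ) :=
  sizeBiasedOffspring η H B ⊗ₖ spineChoice H B

instance {d : ℕ} (η : Measure (Config d)) [IsProbabilityMeasure η] (H : Sph d × ℝ → ℝ)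
    (B : Set ℝ) : IsMarkovKernel (spineKernel η H B) := by
  unfold spineKernel sizeBiasedOffspring spineChoice; infer_instance

theorem measurable_spineNext {d : ℕ} :
    Measurable fun q : (Sph d × ℝ) × (Config d × ℕ) => step q.1 (q.2.1.2 q.2.2) := by
  have h : Measurable fun q : (Sph d × ℝ) × (Config d × ℕ) => q.2.1.2 q.2.2 := by
    have h2 : Measurable fun t : (ℕ → Mat d) × ℕ => t.1 t.2 :=
      measurable_from_prod_countable_left fun j => measurable_pi_apply j
    exact h2.comp ((measurable_snd.comp (measurable_fst.comp measurable_snd)).prodMk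
      (measurable_snd.comp measurable_snd))
  exact measurable_step.comp (measurable_fst.prodMk h)

open Classical in
/-- Attach independent families to all nodes outside the spine: given the sequence of the
positions, offspring configurations and chosen labels along the spine, and an environment `ω`,
the spine `w` consists of the chosen labels, the node `w|k` gets the `k`-th configuration of the
sequence, and all other nodes keep their configuration from `ω`. -/
def assemble {d : ℕ} (x : Sph d) (b : ℝ)
    (q : (ℕ → (Sph d × ℝ) × (Config d × ℕ)) × Env d) : Omega2 d :=
  ((fun u => if u = spineTake (fun k => (q.1 k).2.2) u.length then (q.1 u.length).2.1 else q.2 u,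
    (x, b)), fun k => (q.1 k).2.2)

/-- `ℙ̃_{x,b}`, the law of the branching process with a spine: the spine is a Markov chain that
reproduces by the size-biased point process, and all other particles reproduce independently by
the original point process. -/
def lawSpine {d : ℕ} (η : Measure (Config d)) [IsProbabilityMeasure η] (H : Sph d × ℝ → ℝ)
    (B : Set ℝ) (x : Sph d) (b : ℝ) : Measure (Omega2 d) :=
  ((moveChain (spineKernel η H B) (fun q => step q.1 (q.2.1.2 q.2.2)) measurable_spineNext
    (x, b)).prod (Measure.infinitePi fun _ : List ℕ => η)).map (assemble x b)

/-- The positions `(X_{w|n}, S_{w|n})` along the spine. -/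
def spineWalk {d : ℕ} (ω : Omega2 d) (n : ℕ) : Sph d × ℝ :=
  (X ω.1 (spineTake ω.2 n), S ω.1 (spineTake ω.2 n))

end

end MatrixBRW

open MatrixBRW

namespace MatrixBRW

/-! Write `H` for `Halpha α r h`. Almost everything follows from one joint density,
`lawSpine_apply`. For a word `z` of length `n` and `A ∈ ℱ_n`, the process with a spine gives the
event `A ∩ {w|n = z}` the mass `𝔼[1_A · nodeTerm H B · z] / H(x,b)`. `HasSpineDensity` is this
property for an arbitrary measure.

The density comes from two cancellations. In one step from `p`, the offspring law is biased by `W /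
H(p)`, where `W` is the total weight of the children, and child `j` is then chosen with probability
`w_j / W`. Jointly, the pair (offspring, label) has density `w_j / H(p)` (`lintegral_spineKernel`).
Along a word `z` these ratios telescope: each denominator `H(p)` is the weight of the preceding
node, so only the weight of `z` over `H(x,b)` remains. `lintegral_graft` proves this by induction on
`z`, the branching property being used as invariance of the product law under resampling the
configuration at one node. The bias has mass one by Campbell's formula, the equation `P_α r = r` and
harmonicity of `h` (`lintegral_totalWeight_Halpha`).

For (a), summing the joint density over `z` yields `M_n`, and dividing by `M_n` yields the
conditional law of `w|n`. Conversely, integrating (1) over `A` returns the joint density. The events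
`A ∩ {w|n = z}` form a π-system that generates `σ(ℱ_∞, w)`, hence uniqueness.

For (b), the law of the spine path is expanded over the words `z`. The many-to-one formula
`lintegral_matLaw_eq_tsum`, again by induction on generations, expands the walk in the same way with
the weight `r(y) e^{-αs}`. The two expansions agree term by term up to the factor `h(X_n,S_n) /
h(x,b)`. Part (c) is the case `h = 1`, since finite-dimensional laws determine a law on sequences.
-/

/-- The law of the sequence of moves `(a_k)_{k ≥ 0}` of a chain. -/
noncomputable def actionLaw {Pos Act : Type*} [MeasurableSpace Pos] [MeasurableSpace Act]
    (κ : Kernel Pos Act) [IsMarkovKernel κ] (next : Pos × Act → Pos) (hnext : Measurable next)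
    (p₀ : Pos) : Measure (ℕ → Act) :=
  (moveChain κ next hnext p₀).map fun y k => (y k).2

/-- The positions reached from `p₀` by a sequence of moves. -/
def actPos {Pos Act : Type*} (next : Pos × Act → Pos) (p₀ : Pos) (a : ℕ → Act) : ℕ → Pos
  | 0 => p₀
  | n + 1 => next (actPos next p₀ a n, a n)

theorem actPos_congr {Pos Act : Type*} (next : Pos × Act → Pos) (p₀ : Pos) {a a' : ℕ → Act}
    {n : ℕ} (h : ∀ k < n, a k = a' k) : actPos next p₀ a n = actPos next p₀ a' n := by
  induction n with
  | zero => rfl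
  | succ n ih =>
    rw [actPos, actPos, ih fun k hk => h k (hk.trans n.lt_succ_self), h n n.lt_succ_self]

/-! ### Chains of positions and moves -/

section Chain

variable {Pos Act : Type*} [MeasurableSpace Pos] [MeasurableSpace Act]
  {next : Pos × Act → Pos}

theorem measurable_actPos (hnext : Measurable next) (p₀ : Pos) (n : ℕ) :
    Measurable fun a : ℕ → Act => actPos next p₀ a n := by
  induction n with
  | zero => exact measurable_const
  | succ n ih => exact hnext.comp (ih.prodMk (measurable_pi_apply n))

variable (κ : Kernel Pos Act) [IsMarkovKernel κ] (hnext : Measurable next) (p₀ : Pos)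

instance : IsProbabilityMeasure (moveChain κ next hnext p₀) := by
  unfold moveChain; infer_instance

theorem measurable_moves : Measurable fun (y : ℕ → Pos × Act) k => (y k).2 := by fun_prop

instance : IsProbabilityMeasure (actionLaw κ next hnext p₀) :=
  Measure.isProbabilityMeasure_map measurable_moves.aemeasurable

/-- The trajectory law starts from `μ₀` transported to functions on `Finset.Iic 0`, and its
projection to times `≤ 0` is the identity kernel. Only a measurable equivalence and its inverse
remain. -/
theorem map_zero_trajMeasure {E : ℕ → Type*} [∀ n, MeasurableSpace (E n)] (μ₀ : Measure (E 0))
    [IsProbabilityMeasure μ₀]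
    (κ : (n : ℕ) → Kernel ((i : Finset.Iic n) → E i) (E (n + 1))) [∀ n, IsMarkovKernel (κ n)] :
    (Kernel.trajMeasure μ₀ κ).map (fun y => y 0) = μ₀ := by
  have h : (fun y : (n : ℕ) → E n => y 0)
      = (MeasurableEquiv.piUnique fun i : Finset.Iic 0 => E i) ∘ Preorder.frestrictLe 0 := by
    ext y; rfl
  rw [h]
  refine (Measure.map_map (MeasurableEquiv.measurable _) (by fun_prop)).symm.trans ?_
  rw [Kernel.trajMeasure,
    Measure.map_comp _ _ (by fun_prop), Kernel.traj_map_frestrictLe, Kernel.partialTraj_self,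
    Measure.id_comp]
  exact (MeasurableEquiv.piUnique fun i : Finset.Iic 0 => E i).map_map_symm

theorem lintegral_moveChain_zero {f : Pos × Act → ℝ≥0∞} (hf : Measurable f) :
    ∫⁻ y, f (y 0) ∂moveChain κ next hnext p₀ = ∫⁻ a, f (p₀, a) ∂κ p₀ := by
  have h := map_zero_trajMeasure (E := fun _ => Pos × Act) ((Measure.dirac p₀) ⊗ₘ κ) fun n =>
    ((Kernel.deterministic next hnext) ⊗ₖ (κ.comap Prod.snd measurable_snd)).comap
      (fun y : (i : Finset.Iic n) → Pos × Act => y ⟨n, Finset.mem_Iic.2 le_rfl⟩)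
      (measurable_pi_apply _)
  rw [← lintegral_map (f := f) (g := fun y : ℕ → Pos × Act => y 0) hf (measurable_pi_apply 0)]
  unfold moveChain
  rw [h, Measure.lintegral_compProd hf, lintegral_dirac']
  exact hf.lintegral_kernel_prod_right'

theorem lintegral_moveChain_succ (n : ℕ)
    {f : ((i : Finset.Iic n) → Pos × Act) × (Pos × Act) → ℝ≥0∞} (hf : Measurable f) :
    ∫⁻ y, f (Preorder.frestrictLe n y, y (n + 1)) ∂moveChain κ next hnext p₀ =
      ∫⁻ y, ∫⁻ a, f (Preorder.frestrictLe n y, (next (y n), a)) ∂κ (next (y n))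
        ∂moveChain κ next hnext p₀ := by
  have h := Kernel.map_frestrictLe_trajMeasure_compProd_eq_map_trajMeasure
    (X := fun _ => Pos × Act) (μ₀ := (Measure.dirac p₀) ⊗ₘ κ) (κ := fun n =>
    ((Kernel.deterministic next hnext) ⊗ₖ (κ.comap Prod.snd measurable_snd)).comap
      (fun y : (i : Finset.Iic n) → Pos × Act => y ⟨n, Finset.mem_Iic.2 le_rfl⟩)
      (measurable_pi_apply _)) (a := n)
  rw [← lintegral_map (f := f)
    (g := fun y : ℕ → Pos × Act => (Preorder.frestrictLe (π := fun _ => Pos × Act) n y, y (n + 1)))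
    hf (by fun_prop)]
  unfold moveChain
  rw [← h, Measure.lintegral_compProd hf, lintegral_map _ (by fun_prop)]
  · refine lintegral_congr fun y => ?_
    rw [Kernel.comap_apply, Kernel.lintegral_compProd _ _ _ (by fun_prop),
      Kernel.lintegral_deterministic']
    · rfl
    · exact Measurable.lintegral_kernel_prod_right'
        (κ := (κ.comap Prod.snd measurable_snd).comap (fun b => (_, b)) (by fun_prop))
        (f := fun q : Pos × Act => f (_, (q.1, q.2))) (by fun_prop)
  · exact hf.lintegral_kernel_prod_right'

variable [MeasurableEq Pos]

/-- The positions stored in the chain are redundant: almost surely they can be recomputed from the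
moves. This allows passing to the law of the moves alone. -/
theorem ae_moveChain_position :
    ∀ᵐ y ∂moveChain κ next hnext p₀, ∀ n, (y n).1 = actPos next p₀ (fun k => (y k).2) n := by
  classical
  have h0 : ∀ᵐ y ∂moveChain κ next hnext p₀, (y 0).1 = p₀ := by
    -- The one-step formula is tested on the indicator of the exceptional event; its integral
    -- vanishes.
    have hm : Measurable fun q : Pos × Act => if q.1 = p₀ then (0 : ℝ≥0∞) else 1 :=
      Measurable.ite (measurableSet_eq_fun measurable_fst measurable_const) measurable_const
        measurable_const
    have := lintegral_moveChain_zero κ hnext p₀ hm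
    simp only [if_true, lintegral_zero] at this
    rw [lintegral_eq_zero_iff] at this
    · filter_upwards [this] with y hy
      by_contra hc
      simp [hc] at hy
    · exact hm.comp (measurable_pi_apply (X := fun _ : ℕ => Pos × Act) 0)
  have hS : ∀ n, ∀ᵐ y ∂moveChain κ next hnext p₀, (y (n + 1)).1 = next (y n) := by
    intro n
    have hm : Measurable fun q : ((i : Finset.Iic n) → Pos × Act) × (Pos × Act) =>
        if q.2.1 = next (q.1 ⟨n, Finset.mem_Iic.2 le_rfl⟩) then (0 : ℝ≥0∞) else 1 :=
      Measurable.ite (measurableSet_eq_fun (by fun_prop) (by fun_prop)) measurable_const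
        measurable_const
    have := lintegral_moveChain_succ κ hnext p₀ n hm
    simp only [Preorder.frestrictLe_apply, if_true, lintegral_zero] at this
    rw [lintegral_eq_zero_iff] at this
    · filter_upwards [this] with y hy
      by_contra hc
      simp [hc] at hy
    · exact hm.comp (f := fun y : ℕ → Pos × Act =>
          (Preorder.frestrictLe (π := fun _ => Pos × Act) n y, y (n + 1))) (by fun_prop)
  filter_upwards [h0, ae_all_iff.2 hS] with y hy0 hyS n
  induction n with
  | zero => exact hy0
  | succ n ih => rw [hyS n, actPos, ← ih]

/-- One-step decomposition of the law of the moves. -/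
theorem lintegral_actionLaw_update (n : ℕ) {F : (ℕ → Act) → ℝ≥0∞} (hF : Measurable F)
    (hdep : ∀ a a' : ℕ → Act, (∀ k ≤ n, a k = a' k) → F a = F a') :
    ∫⁻ a, F a ∂actionLaw κ next hnext p₀ =
      ∫⁻ a, ∫⁻ a', F (Function.update a n a') ∂κ (actPos next p₀ a n)
        ∂actionLaw κ next hnext p₀ := by
  have hpos := ae_moveChain_position κ hnext p₀
  have hm : Measurable fun a : ℕ → Act =>
      ∫⁻ a', F (Function.update a n a') ∂κ (actPos next p₀ a n) :=
    Measurable.lintegral_kernel_prod_right'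
      (κ := κ.comap (fun a : ℕ → Act => actPos next p₀ a n) (measurable_actPos hnext p₀ n))
      (f := fun q : (ℕ → Act) × Act => F (Function.update q.1 n q.2)) (by fun_prop)
  unfold actionLaw
  rw [lintegral_map hF measurable_moves, lintegral_map hm measurable_moves]
  -- Time `0` is separate, because the first pair comes from the initial law and not from a
  -- transition.
  cases n with
  | zero =>
    have h1 : ∀ y : ℕ → Pos × Act, F (fun k => (y k).2) = F (fun _ => (y 0).2) := fun y =>
      hdep _ _ fun k hk => by rw [Nat.le_zero.1 hk]
    have h2 : ∀ (y : ℕ → Pos × Act) a', F (Function.update (fun k => (y k).2) 0 a')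
        = F (fun _ => a') := fun y a' => hdep _ _ fun k hk => by simp [Nat.le_zero.1 hk]
    simp_rw [h1, h2, actPos]
    rw [lintegral_moveChain_zero κ hnext p₀ (f := fun q => F fun _ => q.2) (by fun_prop)]
    simp
  | succ n =>
    -- `F` ignores the moves after time `n + 1`. Filling those entries with the move at time `n + 1`
    -- makes `F` a function of the past up to `n` and the new state.
    have h1 : ∀ y : ℕ → Pos × Act, F (fun k => (y k).2) =
        F (fun k => if hk : k ∈ Finset.Iic n then
          (Preorder.frestrictLe (π := fun _ => Pos × Act) n y ⟨k, hk⟩).2 else (y (n + 1)).2) := by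
      refine fun y => hdep _ _ fun k hk => ?_
      split_ifs with h
      · rfl
      · rw [Finset.mem_Iic] at h
        rw [show k = n + 1 by omega]
    simp_rw [h1]
    rw [lintegral_moveChain_succ κ hnext p₀ n
      (f := fun q => F fun k => if hk : k ∈ Finset.Iic n then (q.1 ⟨k, hk⟩).2 else q.2.2)]
    · refine lintegral_congr_ae ?_
      filter_upwards [hpos] with y hy
      rw [actPos, ← hy n]
      refine lintegral_congr fun a' => hdep _ _ fun k hk => ?_
      simp only [Finset.mem_Iic, Preorder.frestrictLe_apply]
      split_ifs with h
      · rw [Function.update_of_ne (by omega)]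
      · rw [show k = n + 1 by omega, Function.update_self]
    · refine hF.comp (measurable_pi_lambda _ fun k => ?_)
      by_cases hk : k ∈ Finset.Iic n
      · simp only [hk, dite_true]; fun_prop
      · simp only [hk, dite_false]; fun_prop

end Chain

/-! ## The walk along a branch -/

section Walk

variable {d : ℕ}

theorem l1norm_div {v : Fin d → ℝ} {c : ℝ} (hc : 0 < c) :
    l1norm (fun i => v i / c) = l1norm v / c := by
  simp only [l1norm, abs_div, abs_of_pos hc, Finset.sum_div]

theorem mul_mulVec_dot (g h : Mat d) (x : Sph d) :
    g.1 *ᵥ (dot h x).1 = fun i => ((g * h).1 *ᵥ x.1) i / l1norm (h.1 *ᵥ x.1) := by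
  ext i
  have : (dot h x).1 = (l1norm (h.1 *ᵥ x.1))⁻¹ • (h.1 *ᵥ x.1) := by
    ext i; simp [dot, div_eq_inv_mul]
  rw [this, Matrix.mulVec_smul, Matrix.mulVec_mulVec, Pi.smul_apply, smul_eq_mul,
    div_eq_inv_mul]
  rfl

theorem dot_mul (g h : Mat d) (x : Sph d) : dot (g * h) x = dot g (dot h x) := by
  have hp := l1norm_mulVec_pos h x
  ext i
  change _ = (g.1 *ᵥ (dot h x).1) i / l1norm (g.1 *ᵥ (dot h x).1)
  rw [mul_mulVec_dot, l1norm_div hp, div_div_div_cancel_right₀ hp.ne']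
  rfl

theorem cocycle_mul (g h : Mat d) (x : Sph d) :
    cocycle (g * h) x = cocycle g (dot h x) + cocycle h x := by
  have hp := l1norm_mulVec_pos h x
  have hq := l1norm_mulVec_pos (g * h) x
  rw [cocycle, cocycle, cocycle, mul_mulVec_dot, l1norm_div hp, Real.log_div hq.ne' hp.ne',
    sub_add_cancel]

theorem dot_one (x : Sph d) : dot (1 : Mat d) x = x := by
  ext i
  simp [dot, x.2.2]

theorem cocycle_one (x : Sph d) : cocycle (1 : Mat d) x = 0 := by
  simp [cocycle, x.2.2]

theorem walk_zero (q : (Sph d × ℝ) × (ℕ → Mat d)) : walk q 0 = q.1 := by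
  simp [walk, walkProd, dot_one, cocycle_one]

/-- By the cocycle relation, the walk defined through matrix products is an iteration of `step`,
hence Markovian in `(X, S)`. -/
theorem walk_succ (q : (Sph d × ℝ) × (ℕ → Mat d)) (n : ℕ) :
    walk q (n + 1) = step (walk q n) (q.2 n) := by
  simp only [walk, walkProd, step, dot_mul, cocycle_mul]
  congr 1
  ring

theorem walk_eq_actPos (q : (Sph d × ℝ) × (ℕ → Mat d)) (n : ℕ) :
    walk q n = actPos (fun t => step t.1 t.2) q.1 q.2 n := by
  induction n with
  | zero => rw [walk_zero, actPos]
  | succ n ih => rw [walk_succ, actPos, ih]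

theorem walk_congr {p : Sph d × ℝ} {g g' : ℕ → Mat d} {n : ℕ} (h : ∀ k < n, g k = g' k) :
    walk (p, g) n = walk (p, g') n := by
  simp only [walk_eq_actPos]
  exact actPos_congr _ _ h

theorem measurable_walk (n : ℕ) :
    Measurable fun q : (Sph d × ℝ) × (ℕ → Mat d) => walk q n := by
  induction n with
  | zero => simp only [walk_zero]; exact measurable_fst
  | succ n ih =>
    simp only [walk_succ]
    exact measurable_step.comp (ih.prodMk ((measurable_pi_apply n).comp measurable_snd))

/-- The matrices along the branch that leads to the node `u`. -/
def branchPath (ω : Env d) (u : List ℕ) (i : ℕ) : Mat d := gMat ω (u.take (i + 1))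

theorem branchProd_eq_walkProd (ω : Env d) (u : List ℕ) (n : ℕ) :
    branchProd ω u n = walkProd (branchPath ω u) n := by
  induction n with
  | zero => rfl
  | succ n ih => rw [branchProd, walkProd, ih, branchPath]

theorem branchProd_take (ω : Env d) (u : List ℕ) {k n : ℕ} (h : k ≤ n) :
    branchProd ω (u.take n) k = branchProd ω u k := by
  induction k with
  | zero => rfl
  | succ k ih => rw [branchProd, branchProd, ih (by omega), List.take_take, min_eq_left h]

/-- The bridge from the tree to the walk. The bound on `k` matters: past `u.length`, `branchPath`
repeats the matrix of `u`, whereas `u.take k` stays at `u`. -/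
theorem node_take_eq_walk (ω : Omega1 d) (u : List ℕ) {k : ℕ} (hk : k ≤ u.length) :
    (X ω (u.take k), S ω (u.take k)) = walk (ω.2, branchPath ω.1 u) k := by
  rw [X, S, G, List.length_take, min_eq_left hk, branchProd_take _ _ le_rfl,
    branchProd_eq_walkProd, walk]

theorem node_eq_walk (ω : Omega1 d) (u : List ℕ) :
    (X ω u, S ω u) = walk (ω.2, branchPath ω.1 u) u.length := by
  simpa using node_take_eq_walk ω u le_rfl

theorem gMat_append (ω : Env d) (u : List ℕ) (j : ℕ) : gMat ω (u ++ [j]) = (ω u).2 j := by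
  simp [gMat]

theorem branchPath_append_of_lt (ω : Env d) (u : List ℕ) (j : ℕ) {i : ℕ} (hi : i < u.length) :
    branchPath ω (u ++ [j]) i = branchPath ω u i := by
  rw [branchPath, branchPath, List.take_append_of_le_length (by omega)]

theorem branchPath_append_length (ω : Env d) (u : List ℕ) (j : ℕ) :
    branchPath ω (u ++ [j]) u.length = (ω u).2 j := by
  rw [branchPath, List.take_of_length_le (by simp), gMat_append]

theorem node_append (ω : Omega1 d) (u : List ℕ) (j : ℕ) :
    (X ω (u ++ [j]), S ω (u ++ [j])) = step (X ω u, S ω u) ((ω.1 u).2 j) := by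
  rw [node_eq_walk, node_eq_walk, List.length_append, List.length_singleton, walk_succ]
  simp only [branchPath_append_length]
  rw [walk_congr fun k hk => branchPath_append_of_lt ω.1 u j hk]

theorem inTree_nil (ω : Env d) : InTree ω [] := fun k hk => absurd hk (by simp)

theorem inTree_append (ω : Env d) (u : List ℕ) (j : ℕ) :
    InTree ω (u ++ [j]) ↔ InTree ω u ∧ (j : ℕ∞) < (ω u).1 := by
  constructor
  · intro h
    refine ⟨fun k hk => ?_, ?_⟩
    · have := h k (by simp; omega)
      rwa [List.getElem_append_left hk, List.take_append_of_le_length hk.le] at this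
    · simpa using h u.length (by simp)
  · rintro ⟨h, hj⟩ k hk
    rcases (show k < u.length ∨ k = u.length by simp at hk; omega) with hk' | rfl
    · rw [List.getElem_append_left hk', List.take_append_of_le_length hk'.le]
      exact h k hk'
    · simpa using hj

theorem InTree.take {ω : Env d} {u : List ℕ} (h : InTree ω u) (n : ℕ) : InTree ω (u.take n) := by
  intro k hk
  have hk' : k < n ∧ k < u.length := by simpa using hk
  rw [List.getElem_take, List.take_take, min_eq_left hk'.1.le]
  exact h k hk'.2

theorem inTree_congr {ω ω' : Env d} {u : List ℕ}
    (h : ∀ k < u.length, ω (u.take k) = ω' (u.take k)) : InTree ω u ↔ InTree ω' u := by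
  unfold InTree
  exact forall_congr' fun k => forall_congr' fun hk => by rw [h k hk]

/-- The matrix of a node is stored in the configuration of its parent, so only the proper ancestors
of `u` count. -/
theorem branchPath_congr {ω ω' : Env d} {u : List ℕ}
    (h : ∀ k < u.length, ω (u.take k) = ω' (u.take k)) : branchPath ω u = branchPath ω' u := by
  ext1 i
  rcases u.eq_nil_or_concat with rfl | ⟨v, j, rfl⟩
  · simp [branchPath, gMat]
  · unfold branchPath gMat
    split_ifs with h0
    · rfl
    · have : (((v.concat j).take (i + 1)).dropLast) = (v.concat j).take (min i v.length) := by
        rw [List.dropLast_eq_take, List.take_take, List.length_take, List.length_concat]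
        congr 1
        omega
      rw [this, h _ (by rw [List.length_concat]; omega)]

/-- The node `u` belongs to the tree and its ancestral line stays in `B`. -/
def Alive (B : Set ℝ) (ω : Omega1 d) (u : List ℕ) : Prop :=
  InTree ω.1 u ∧ ∀ k ≤ u.length, S ω (u.take k) ∈ B

theorem alive_iff_walk (B : Set ℝ) (ω : Omega1 d) (u : List ℕ) :
    Alive B ω u ↔ InTree ω.1 u ∧ ∀ k ≤ u.length, (walk (ω.2, branchPath ω.1 u) k).2 ∈ B := by
  refine and_congr_right fun _ => forall_congr' fun k => forall_congr' fun hk => ?_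
  rw [← node_take_eq_walk ω u hk]

theorem alive_congr (B : Set ℝ) {ω ω' : Env d} {p : Sph d × ℝ} {u : List ℕ}
    (h : ∀ k < u.length, ω (u.take k) = ω' (u.take k)) : Alive B (ω, p) u ↔ Alive B (ω', p) u := by
  rw [alive_iff_walk, alive_iff_walk]
  simp only [inTree_congr h, branchPath_congr h]

theorem node_congr {ω ω' : Env d} {p : Sph d × ℝ} {u : List ℕ}
    (h : ∀ k < u.length, ω (u.take k) = ω' (u.take k)) :
    (X (ω, p) u, S (ω, p) u) = (X (ω', p) u, S (ω', p) u) := by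
  rw [node_eq_walk, node_eq_walk]
  simp only [branchPath_congr h]

theorem alive_append (B : Set ℝ) (ω : Omega1 d) (u : List ℕ) (j : ℕ) :
    Alive B ω (u ++ [j]) ↔ Alive B ω u ∧ (j : ℕ∞) < (ω.1 u).1 ∧
      (step (X ω u, S ω u) ((ω.1 u).2 j)).2 ∈ B := by
  have h1 : (∀ k ≤ (u ++ [j]).length, S ω ((u ++ [j]).take k) ∈ B) ↔
      (∀ k ≤ u.length, S ω (u.take k) ∈ B) ∧
        (step (X ω u, S ω u) ((ω.1 u).2 j)).2 ∈ B := by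
    rw [← node_append]
    constructor
    · intro h
      refine ⟨fun k hk => ?_, ?_⟩
      · have := h k (by simp; omega)
        rwa [List.take_append_of_le_length hk] at this
      · have := h _ le_rfl
        rwa [List.take_length] at this
    · rintro ⟨h, h'⟩ k hk
      rcases (show k ≤ u.length ∨ k = (u ++ [j]).length by simp at hk ⊢; omega) with hk' | rfl
      · rw [List.take_append_of_le_length hk']
        exact h k hk'
      · rwa [List.take_length]
  rw [Alive, h1, inTree_append, Alive]
  tauto

open Classical in
theorem nodeTerm_eq (H : Sph d × ℝ → ℝ) (B : Set ℝ) (ω : Omega1 d) (u : List ℕ) :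
    nodeTerm H B ω u = if Alive B ω u then ENNReal.ofReal (H (X ω u, S ω u)) else 0 := by
  unfold nodeTerm Alive
  congr

open Classical in
-- The branching recursion for the weights. Whether `u` is alive and where it sits do not involve
-- the configuration at `u`, so that configuration can later be averaged with the rest frozen.
theorem nodeTerm_append (H : Sph d × ℝ → ℝ) (B : Set ℝ) (ω : Omega1 d) (u : List ℕ) (j : ℕ) :
    nodeTerm H B ω (u ++ [j]) =
      if Alive B ω u then childWeight H B (X ω u, S ω u) (ω.1 u) j else 0 := by
  rw [nodeTerm_eq, node_append, childWeight]
  simp only [alive_append]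
  split_ifs <;> tauto

end Walk

/-! ## Measurability -/

section Measurability

variable {d : ℕ}

theorem measurable_configMat (j : ℕ) : Measurable fun c : Config d => c.2 j :=
  (measurable_pi_apply j).comp measurable_snd

theorem measurableSet_lt_config (j : ℕ) : MeasurableSet {c : Config d | (j : ℕ∞) < c.1} :=
  measurable_fst (MeasurableSet.of_discrete (s := {n : ℕ∞ | (j : ℕ∞) < n}))

theorem measurable_gMat (u : List ℕ) : Measurable fun ω : Env d => gMat ω u := by
  unfold gMat
  split_ifs
  · exact measurable_const
  · exact (measurable_configMat _).comp (measurable_pi_apply _)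

theorem measurable_branchPath (u : List ℕ) : Measurable fun ω : Env d => branchPath ω u :=
  measurable_pi_lambda _ fun _ => measurable_gMat _

theorem measurableSet_inTree (u : List ℕ) : MeasurableSet {ω : Env d | InTree ω u} := by
  have : {ω : Env d | InTree ω u}
      = ⋂ k : Fin u.length, (fun ω : Env d => ω (u.take k)) ⁻¹' {c | ((u[k] : ℕ) : ℕ∞) < c.1} := by
    ext ω
    simp only [Set.mem_iInter]
    exact ⟨fun h k => h k k.2, fun h k hk => h ⟨k, hk⟩⟩
  rw [this]
  exact MeasurableSet.iInter fun k => measurable_pi_apply _ (measurableSet_lt_config _)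

theorem measurable_node (u : List ℕ) : Measurable fun ω : Omega1 d => (X ω u, S ω u) := by
  simp only [node_eq_walk]
  exact (measurable_walk _).comp
    (measurable_snd.prodMk ((measurable_branchPath u).comp measurable_fst))

theorem measurableSet_alive {B : Set ℝ} (hB : MeasurableSet B) (u : List ℕ) :
    MeasurableSet {ω : Omega1 d | Alive B ω u} := by
  have : {ω : Omega1 d | Alive B ω u} = (Prod.fst ⁻¹' {ω | InTree ω u}) ∩
      ⋂ k : Fin (u.length + 1), (fun ω : Omega1 d => S ω (u.take k)) ⁻¹' B := by
    ext ω
    simp only [Set.mem_inter_iff, Set.mem_iInter]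
    exact and_congr_right fun _ => ⟨fun h k => h k (Nat.lt_succ_iff.1 k.2),
      fun h k hk => h ⟨k, Nat.lt_succ_iff.2 hk⟩⟩
  rw [this]
  exact (measurable_fst (measurableSet_inTree u)).inter
    (MeasurableSet.iInter fun k => (measurable_node _).snd hB)

theorem measurable_nodeTerm {H : Sph d × ℝ → ℝ} (hH : Measurable H) {B : Set ℝ}
    (hB : MeasurableSet B) (u : List ℕ) : Measurable fun ω : Omega1 d => nodeTerm H B ω u := by
  classical
  exact Measurable.ite (measurableSet_alive hB u)
    (hH.comp (measurable_node u)).ennreal_ofReal measurable_const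

theorem measurable_martM {H : Sph d × ℝ → ℝ} (hH : Measurable H) {B : Set ℝ}
    (hB : MeasurableSet B) (n : ℕ) : Measurable (martM (d := d) H B n) :=
  Measurable.tsum fun u => measurable_nodeTerm hH hB u.1

theorem measurable_childWeight {H : Sph d × ℝ → ℝ} (hH : Measurable H) {B : Set ℝ}
    (hB : MeasurableSet B) (j : ℕ) :
    Measurable fun q : (Sph d × ℝ) × Config d => childWeight H B q.1 q.2 j := by
  classical
  have hs : Measurable fun q : (Sph d × ℝ) × Config d => step q.1 (q.2.2 j) :=
    measurable_step.comp (measurable_fst.prodMk ((measurable_configMat j).comp measurable_snd))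
  exact Measurable.ite ((measurable_snd (measurableSet_lt_config j)).inter (hs.snd hB))
    (hH.comp hs).ennreal_ofReal measurable_const

theorem measurable_totalWeight {H : Sph d × ℝ → ℝ} (hH : Measurable H) {B : Set ℝ}
    (hB : MeasurableSet B) :
    Measurable fun q : (Sph d × ℝ) × Config d => totalWeight H B q.1 q.2 :=
  Measurable.tsum fun j => measurable_childWeight hH hB j

end Measurability

/-! ## The filtration -/

section Filtration

variable {d : ℕ}

theorem filtF_mono {m n : ℕ} (h : m ≤ n) : filtF d m ≤ filtF d n :=
  sup_le_sup le_rfl (biSup_mono fun _ hu => hu.trans h)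

theorem measurable_snd_filtF (n : ℕ) : Measurable[filtF d n] (Prod.snd : Omega1 d → _) :=
  Measurable.of_comap_le le_sup_left

theorem measurableSet_inTree_filtF {n : ℕ} {u : List ℕ} (hu : u.length ≤ n) :
    MeasurableSet[filtF d n] {ω : Omega1 d | InTree ω.1 u} := by
  refine le_trans ?_ (le_sup_right : _ ≤ filtF d n) _
    (MeasurableSpace.measurableSet_generateFrom (Set.mem_singleton _))
  exact le_trans le_sup_left (le_iSup₂_of_le u hu le_rfl)

open Classical in
/-- The matrices along the branch to `u`, with the identity for the nodes outside the tree. -/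
noncomputable def treePath (ω : Env d) (u : List ℕ) (i : ℕ) : Mat d :=
  if InTree ω (u.take (i + 1)) then gMat ω (u.take (i + 1)) else 1

theorem treePath_eq {ω : Env d} {u : List ℕ} (h : InTree ω u) : treePath ω u = branchPath ω u := by
  ext1 i
  rw [treePath, if_pos (h.take _), branchPath]

/-- The purpose of `treePath`: `ℱ_n` records `g_u` only on `{u ∈ 𝕋}`, so `branchPath` need not be
`ℱ_n`-measurable, but the path with the identity outside the tree is. -/
theorem measurable_treePath_filtF {n : ℕ} {u : List ℕ} (hu : u.length ≤ n) :
    Measurable[filtF d n] fun ω : Omega1 d => treePath ω.1 u := by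
  refine @measurable_pi_lambda _ _ _ (filtF d n) _ _ fun i => Measurable.of_comap_le ?_
  refine le_trans ?_ (le_sup_right : _ ≤ filtF d n)
  refine le_trans ?_ (le_iSup₂_of_le (u.take (i + 1)) (by simp; omega) le_rfl)
  exact le_sup_right

theorem measurable_treeWalk_filtF {n : ℕ} {u : List ℕ} (hu : u.length ≤ n) (k : ℕ) :
    Measurable[filtF d n] fun ω : Omega1 d => walk (ω.2, treePath ω.1 u) k :=
  (measurable_walk k).comp
    (@Measurable.prodMk _ (filtF d n) _ _ _ _ (fun ω => ω.2) _ (measurable_snd_filtF n)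
      (measurable_treePath_filtF hu))

theorem measurableSet_alive_filtF {B : Set ℝ} (hB : MeasurableSet B) {n : ℕ} {u : List ℕ}
    (hu : u.length ≤ n) : MeasurableSet[filtF d n] {ω : Omega1 d | Alive B ω u} := by
  have : {ω : Omega1 d | Alive B ω u} = {ω : Omega1 d | InTree ω.1 u} ∩
      ⋂ k : Fin (u.length + 1), (fun ω : Omega1 d => (walk (ω.2, treePath ω.1 u) k).2) ⁻¹' B := by
    ext ω
    simp only [Set.mem_inter_iff, Set.mem_iInter]
    refine (alive_iff_walk B ω u).trans (and_congr_right fun h => ?_)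
    rw [← treePath_eq h]
    exact ⟨fun h k => h k (Nat.lt_succ_iff.1 k.2),
      fun h k hk => h ⟨k, Nat.lt_succ_iff.2 hk⟩⟩
  rw [this]
  refine MeasurableSet.inter (measurableSet_inTree_filtF hu) (MeasurableSet.iInter fun k => ?_)
  exact (Measurable.snd (m := filtF d n) (measurable_treeWalk_filtF hu k)) hB

open Classical in
theorem nodeTerm_eq_treePath (H : Sph d × ℝ → ℝ) (B : Set ℝ) (ω : Omega1 d) (u : List ℕ) :
    nodeTerm H B ω u = if Alive B ω u then
      ENNReal.ofReal (H (walk (ω.2, treePath ω.1 u) u.length)) else 0 := by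
  rw [nodeTerm_eq, node_eq_walk]
  split_ifs with h
  · rw [treePath_eq h.1]
  · rfl

theorem measurable_nodeTerm_filtF {H : Sph d × ℝ → ℝ} (hH : Measurable H) {B : Set ℝ}
    (hB : MeasurableSet B) {n : ℕ} {u : List ℕ} (hu : u.length ≤ n) :
    Measurable[filtF d n] fun ω : Omega1 d => nodeTerm H B ω u := by
  classical
  simp only [nodeTerm_eq_treePath]
  exact Measurable.ite (measurableSet_alive_filtF hB hu)
    (hH.comp (measurable_treeWalk_filtF hu _)).ennreal_ofReal measurable_const

theorem measurable_martM_filtF {H : Sph d × ℝ → ℝ} (hH : Measurable H) {B : Set ℝ}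
    (hB : MeasurableSet B) (n : ℕ) : Measurable[filtF d n] (martM (d := d) H B n) :=
  @Measurable.tsum _ _ _ (filtF d n) _ _ _ _ _ _ _ _ _ _ _ _
    fun u : {u : List ℕ // u.length = n} => measurable_nodeTerm_filtF hH hB u.2.le

/-- The restriction of an environment to the nodes of the generations before `n`. -/
def restrictGen (n : ℕ) (ω : Omega1 d) : ({u : List ℕ // u.length < n} → Config d) × (Sph d × ℝ) :=
  (fun u => ω.1 u, ω.2)

theorem measurable_restrictGen (n : ℕ) : Measurable (restrictGen (d := d) n) := by
  unfold restrictGen; fun_prop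

/-- For `|u| ≤ n`, both the event `u ∈ 𝕋` and the matrix `g_u` are read off from the configurations
of proper ancestors, which have generation below `n`. -/
theorem filtF_le_comap_restrictGen (n : ℕ) :
    filtF d n ≤ MeasurableSpace.comap (restrictGen n) inferInstance := by
  classical
  -- `ρ` fills the generations from `n` on with a fixed childless configuration. Each generator of
  -- `ℱ_n` is unchanged under `ρ ∘ restrictGen n`, hence factors through `restrictGen n`.
  let ρ : ({u : List ℕ // u.length < n} → Config d) × (Sph d × ℝ) → Omega1 d := fun q =>
    (fun u => if h : u.length < n then q.1 ⟨u, h⟩ else (0, fun _ => 1), q.2)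
  have hρ : Measurable ρ := by
    refine (measurable_pi_lambda _ fun u => ?_).prodMk measurable_snd
    by_cases h : u.length < n
    · simp only [h, dite_true]; fun_prop
    · simp only [h, dite_false]; exact measurable_const
  have hag : ∀ (ω : Omega1 d) (u : List ℕ), u.length ≤ n → ∀ k < u.length,
      ω.1 (u.take k) = (ρ (restrictGen n ω)).1 (u.take k) := by
    intro ω u hu k hk
    have : (u.take k).length < n := by rw [List.length_take]; omega
    simp only [ρ, this, dite_true, restrictGen]
  have hmeas : ∀ {E : Type} [MeasurableSpace E] (f : Omega1 d → E), Measurable f →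
      Measurable[MeasurableSpace.comap (restrictGen n) inferInstance]
        fun ω => f (ρ (restrictGen n ω)) := fun f hf =>
    (hf.comp hρ).comp (comap_measurable (restrictGen n))
  refine sup_le ?_ (iSup₂_le fun u hu => sup_le ?_ ?_)
  · exact (hmeas (E := Sph d × ℝ) Prod.snd measurable_snd).comap_le
  · refine MeasurableSpace.generateFrom_le fun A hA => ?_
    rw [Set.mem_singleton_iff.1 hA]
    refine ⟨ρ ⁻¹' {ω | InTree ω.1 u}, hρ (measurable_fst (measurableSet_inTree u)), ?_⟩
    ext ω
    exact (inTree_congr (hag ω u hu)).symm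
  · have hg : ∀ ω : Env d, gMat ω u = branchPath ω u u.length := fun ω => by
      rw [branchPath, List.take_of_length_le (by omega)]
    have h := hmeas (fun ω : Omega1 d => if InTree ω.1 u then gMat ω.1 u else 1)
      (Measurable.ite (measurable_fst (measurableSet_inTree u))
        ((measurable_gMat u).comp measurable_fst) measurable_const)
    have heq : (fun ω : Omega1 d => if InTree ω.1 u then gMat ω.1 u else 1) =
        fun ω => if InTree (ρ (restrictGen n ω)).1 u then gMat (ρ (restrictGen n ω)).1 u
          else 1 := by
      ext1 ω
      simp only [inTree_congr (hag ω u hu), hg, branchPath_congr (hag ω u hu)]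
    rw [heq]
    exact h.comap_le

theorem filtF_le (n : ℕ) : filtF d n ≤ (inferInstance : MeasurableSpace (Omega1 d)) :=
  (filtF_le_comap_restrictGen n).trans (measurable_restrictGen n).comap_le

/-- Events of `ℱ_n` depend only on the offspring of the generations before `n`. -/
theorem mem_congr_of_measurableSet_filtF {n : ℕ} {A : Set (Omega1 d)}
    (hA : MeasurableSet[filtF d n] A) {ω ω' : Env d} {p : Sph d × ℝ}
    (h : ∀ u : List ℕ, u.length < n → ω u = ω' u) : (ω, p) ∈ A ↔ (ω', p) ∈ A := by
  obtain ⟨C, -, rfl⟩ := filtF_le_comap_restrictGen n A hA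
  have : restrictGen n (ω, p) = restrictGen n (ω', p) :=
    Prod.ext (funext fun u => h u u.2) rfl
  rw [Set.mem_preimage, Set.mem_preimage, this]

end Filtration

/-! ## Integrals against the kernels -/

/-- Where the density has mass one, the default measure `ν₀` plays no role. -/
theorem lintegral_densityKernel {Act Obs : Type*} [MeasurableSpace Act] [MeasurableSpace Obs]
    (ν : Measure Obs) [SFinite ν] {f : Act → Obs → ℝ≥0∞} (hf : Measurable (Function.uncurry f))
    (ν₀ : Measure Obs) {a : Act} (ha : ∫⁻ y, f a y ∂ν = 1) {φ : Obs → ℝ≥0∞} (hφ : Measurable φ) :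
    ∫⁻ y, φ y ∂densityKernel ν f ν₀ a = ∫⁻ y, f a y * φ y ∂ν := by
  classical
  rw [densityKernel, dif_pos hf, Kernel.piecewise_apply, if_pos (by exact ha),
    Kernel.lintegral_withDensity _ hf _ hφ, Kernel.const_apply]

section Intensity

variable {d : ℕ} (η : Measure (Config d))

theorem lintegral_intensity {φ : Mat d → ℝ≥0∞} (hφ : Measurable φ) :
    ∫⁻ g, φ g ∂intensity η = ∑' j : ℕ, ∫⁻ c in {c | (j : ℕ∞) < c.1}, φ (c.2 j) ∂η := by
  rw [intensity, lintegral_sum_measure]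
  exact tsum_congr fun j => lintegral_map hφ (measurable_configMat j)

end Intensity

/-! ## The Markov random walk -/

section WalkLaw

variable {d : ℕ} (η : Measure (Config d)) {α : ℝ} {r : Sph d → ℝ}

/-- The density of the transition kernel of the walk. -/
noncomputable def walkDensity (α : ℝ) (r : Sph d → ℝ) (p : Sph d × ℝ) (g : Mat d) : ℝ≥0∞ :=
  ENNReal.ofReal (Real.exp (α * cocycle g p.1) * r (dot g p.1) / r p.1)

theorem measurable_cocycle_dot :
    Measurable fun q : (Sph d × ℝ) × Mat d => (dot q.2 q.1.1, cocycle q.2 q.1.1) := by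
  refine measurable_step.fst.prodMk ?_
  have : (fun q : (Sph d × ℝ) × Mat d => cocycle q.2 q.1.1) =
      fun q => q.1.2 - (step q.1 q.2).2 := by
    ext q; simp [step]
  rw [this]
  exact measurable_fst.snd.sub measurable_step.snd

theorem measurable_walkDensity (hr : Measurable r) :
    Measurable (Function.uncurry (walkDensity (d := d) α r)) := by
  refine Measurable.ennreal_ofReal (Measurable.div (Measurable.mul ?_ ?_) ?_)
  · exact (measurable_cocycle_dot.snd.const_mul α).exp
  · exact hr.comp measurable_cocycle_dot.fst
  · exact hr.comp measurable_fst.fst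

variable (hr_meas : Measurable r) (hr_pos : ∀ x, 0 < r x) (hr : ∀ x, transferOp η α r x = r x)

include hr_pos hr in
theorem lintegral_walkDensity (p : Sph d × ℝ) : ∫⁻ g, walkDensity α r p g ∂intensity η = 1 := by
  have h0 : ∫ g, Real.exp (α * cocycle g p.1) * r (dot g p.1) ∂intensity η = r p.1 := hr p.1
  -- A non-integrable function has Bochner integral `0` by convention, which `r > 0` excludes; so
  -- the eigenvalue equation itself yields integrability.
  have hint : Integrable (fun g => Real.exp (α * cocycle g p.1) * r (dot g p.1)) (intensity η) := by
    by_contra hc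
    rw [integral_undef hc] at h0
    exact (hr_pos p.1).ne h0
  have h1 : ∫ g, Real.exp (α * cocycle g p.1) * r (dot g p.1) / r p.1 ∂intensity η = 1 := by
    rw [integral_div, h0, div_self (hr_pos _).ne']
  unfold walkDensity
  rw [← ofReal_integral_eq_lintegral_ofReal (hint.div_const _), h1, ENNReal.ofReal_one]
  exact Filter.Eventually.of_forall fun g =>
    div_nonneg (mul_nonneg (Real.exp_pos _).le (hr_pos _).le) (hr_pos _).le

variable [SFinite η]

include hr_meas hr_pos hr in
theorem lintegral_walkKernel (p : Sph d × ℝ) {φ : Mat d → ℝ≥0∞} (hφ : Measurable φ) :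
    ∫⁻ g, φ g ∂walkKernel η α r p = ∫⁻ g, walkDensity α r p g * φ g ∂intensity η :=
  lintegral_densityKernel _ (measurable_walkDensity hr_meas) _
    (lintegral_walkDensity η hr_pos hr p) hφ

/-- The law of the sequence of matrices of the walk. -/
noncomputable def matLaw (α : ℝ) (r : Sph d → ℝ) (p : Sph d × ℝ) : Measure (ℕ → Mat d) :=
  actionLaw (walkKernel η α r) (fun q => step q.1 q.2) measurable_step p

instance (p : Sph d × ℝ) : IsProbabilityMeasure (matLaw η α r p) := by
  unfold matLaw; infer_instance

theorem lawQ_eq_map (x : Sph d) (b : ℝ) :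
    lawQ η α r x b = (matLaw η α r (x, b)).map fun g => ((x, b), g) := by
  rw [matLaw, actionLaw, Measure.map_map (by fun_prop) measurable_moves]
  rfl

instance (x : Sph d) (b : ℝ) : IsProbabilityMeasure (lawQ η α r x b) := by
  rw [lawQ_eq_map]
  exact Measure.isProbabilityMeasure_map (by fun_prop)

theorem ae_lawQ_fst (x : Sph d) (b : ℝ) : ∀ᵐ q ∂lawQ η α r x b, q.1 = (x, b) := by
  have hs : MeasurableSet {q : (Sph d × ℝ) × (ℕ → Mat d) | q.1 = (x, b)} :=
    measurable_fst (measurableSet_singleton _)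
  rw [lawQ_eq_map, ae_map_iff (by fun_prop) hs]
  exact Filter.Eventually.of_forall fun g => rfl

theorem lintegral_lawQ (x : Sph d) (b : ℝ) {f : (Sph d × ℝ) × (ℕ → Mat d) → ℝ≥0∞}
    (hf : Measurable f) :
    ∫⁻ q, f q ∂lawQ η α r x b = ∫⁻ g, f ((x, b), g) ∂matLaw η α r (x, b) := by
  rw [lawQ_eq_map, lintegral_map hf (by fun_prop)]

/-- One-step decomposition of the law of the matrices. -/
theorem lintegral_matLaw_update (p : Sph d × ℝ) (n : ℕ) {F : (ℕ → Mat d) → ℝ≥0∞}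
    (hF : Measurable F) (hdep : ∀ a a' : ℕ → Mat d, (∀ k ≤ n, a k = a' k) → F a = F a') :
    ∫⁻ a, F a ∂matLaw η α r p =
      ∫⁻ a, ∫⁻ g, F (Function.update a n g) ∂walkKernel η α r (walk (p, a) n)
        ∂matLaw η α r p := by
  simp only [walk_eq_actPos]
  exact lintegral_actionLaw_update _ _ _ n hF hdep

/-- Harmonicity is formulated through the position at time one under `lawQ`. The first matrix has
law `walkKernel` at the starting point, which makes it an integral equation for the kernel. -/
theorem lintegral_harmonic_walkKernel {B : Set ℝ} (hB : MeasurableSet B) {h : Sph d × ℝ → ℝ}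
    (hh : IsPositiveHarmonic η α r B h) (p : Sph d × ℝ) (hp : p.2 ∈ B) :
    ∫⁻ g in {g | (step p g).2 ∈ B}, ENNReal.ofReal (h (step p g)) ∂walkKernel η α r p =
      ENNReal.ofReal (h p) := by
  obtain ⟨x, b⟩ := p
  have hst : Measurable (step (x, b)) := measurable_step.comp (measurable_const.prodMk measurable_id)
  have hS : MeasurableSet {g | (step (x, b) g).2 ∈ B} := hst.snd hB
  have hw := measurable_walk (d := d) 1
  have hW : MeasurableSet {q : (Sph d × ℝ) × (ℕ → Mat d) | (walk q 1).2 ∈ B} := hw.snd hB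
  have hm : Measurable ({q : (Sph d × ℝ) × (ℕ → Mat d) | (walk q 1).2 ∈ B}.indicator
      fun q => ENNReal.ofReal (h (walk q 1))) := (hh.1.comp hw).ennreal_ofReal.indicator hW
  have h1 : ∀ a : ℕ → Mat d, walk ((x, b), a) 1 = step (x, b) (a 0) := fun a => by
    rw [walk_succ, walk_zero]
  rw [← (hh.2 x b hp).2, ← lintegral_indicator hW]
  refine Eq.trans ?_ (lintegral_lawQ η x b hm).symm
  have h2 : ∀ a : ℕ → Mat d, {q : (Sph d × ℝ) × (ℕ → Mat d) | (walk q 1).2 ∈ B}.indicator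
      (fun q => ENNReal.ofReal (h (walk q 1))) ((x, b), a) =
        {g | (step (x, b) g).2 ∈ B}.indicator (fun g => ENNReal.ofReal (h (step (x, b) g)))
          (a 0) := fun a => by
    by_cases hc : (step (x, b) (a 0)).2 ∈ B <;> simp [Set.indicator, h1, hc]
  simp only [h2]
  refine Eq.trans ?_ (lintegral_matLaw_update η (x, b) 0
    (((hh.1.comp hst).ennreal_ofReal.indicator hS).comp (measurable_pi_apply 0)) ?_).symm
  · rw [← lintegral_indicator hS]
    simp only [walk_zero, Function.comp, Function.update_self, lintegral_const, measure_univ,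
      mul_one]
  · intro a a' h
    simp only [Function.comp, h 0 le_rfl]

end WalkLaw

/-! ## The spine kernel -/

section SpineKernel

variable {d : ℕ} (η : Measure (Config d)) {α : ℝ} {r : Sph d → ℝ}

theorem measurable_Halpha (hr : Measurable r) {h : Sph d × ℝ → ℝ} (hh : Measurable h) :
    Measurable (Halpha α r h) :=
  ((hr.comp measurable_fst).mul hh).mul (measurable_snd.const_mul (-α)).exp

/-- As `S` decreases by `σ`, the factor `e^{-αS}` gains `e^{ασ}`. The weight of a child is therefore
a prefactor of the parent times the transition density of `ℚ^α` times `h`. -/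
theorem Halpha_step (hr_pos : ∀ x, 0 < r x) (h : Sph d × ℝ → ℝ) (p : Sph d × ℝ) (g : Mat d) :
    ENNReal.ofReal (Halpha α r h (step p g)) =
      ENNReal.ofReal (r p.1 * Real.exp (-α * p.2)) *
        (walkDensity α r p g * ENNReal.ofReal (h (step p g))) := by
  have := (hr_pos p.1).ne'
  have h1 := (hr_pos p.1).le
  have h2 := (hr_pos (dot g p.1)).le
  rw [walkDensity, ← ENNReal.ofReal_mul (by positivity), ← ENNReal.ofReal_mul (by positivity)]
  congr 1
  have he : Real.exp (-α * (step p g).2) = Real.exp (-α * p.2) * Real.exp (α * cocycle g p.1) := by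
    rw [← Real.exp_add, step]; congr 1; ring
  rw [Halpha, he, step]
  field_simp

/-- Campbell's formula for a point process with intensity `μ`. -/
theorem lintegral_totalWeight {H : Sph d × ℝ → ℝ} (hH : Measurable H) {B : Set ℝ}
    (hB : MeasurableSet B) (p : Sph d × ℝ) :
    ∫⁻ c, totalWeight H B p c ∂η =
      ∫⁻ g in {g | (step p g).2 ∈ B}, ENNReal.ofReal (H (step p g)) ∂intensity η := by
  classical
  have hst : Measurable (step p) := measurable_step.comp (measurable_const.prodMk measurable_id)
  have hS : MeasurableSet {g | (step p g).2 ∈ B} := hst.snd hB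
  have hm : Measurable ({g | (step p g).2 ∈ B}.indicator
      fun g => ENNReal.ofReal (H (step p g))) := (hH.comp hst).ennreal_ofReal.indicator hS
  rw [← lintegral_indicator hS, lintegral_intensity η hm]
  unfold totalWeight
  have hcw : ∀ j, Measurable fun c => childWeight H B p c j := fun j =>
    (measurable_childWeight hH hB j).comp measurable_prodMk_left
  rw [lintegral_tsum fun j => (hcw j).aemeasurable]
  refine tsum_congr fun j => ?_
  rw [← lintegral_indicator (measurableSet_lt_config j)]
  refine lintegral_congr fun c => ?_
  by_cases h1 : (j : ℕ∞) < c.1 <;> by_cases h2 : (step p (c.2 j)).2 ∈ B <;>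
    simp [childWeight, Set.indicator, h1, h2]

/-- Harmonicity of `h` enters here. The identity says that the size-biased offspring density has
mass one inside `B`, and thus that the spine kernel is the intended one there. -/
theorem lintegral_totalWeight_Halpha [SFinite η] (hr_meas : Measurable r) (hr_pos : ∀ x, 0 < r x)
    (hr : ∀ x, transferOp η α r x = r x) {B : Set ℝ} (hB : MeasurableSet B) {h : Sph d × ℝ → ℝ}
    (hh : IsPositiveHarmonic η α r B h) (p : Sph d × ℝ) (hp : p.2 ∈ B) :
    ∫⁻ c, totalWeight (Halpha α r h) B p c ∂η = ENNReal.ofReal (Halpha α r h p) := by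
  have hst : Measurable (step p) := measurable_step.comp (measurable_const.prodMk measurable_id)
  have hm : Measurable fun g => ENNReal.ofReal (h (step p g)) := (hh.1.comp hst).ennreal_ofReal
  have hd : Measurable (walkDensity α r p) := (measurable_walkDensity hr_meas).of_uncurry_left
  rw [lintegral_totalWeight η (measurable_Halpha hr_meas hh.1) hB]
  simp only [Halpha_step hr_pos]
  have hS : MeasurableSet {g | (step p g).2 ∈ B} := hst.snd hB
  have h1 := lintegral_harmonic_walkKernel η hB hh p hp
  rw [← lintegral_indicator hS, lintegral_walkKernel η hr_meas hr_pos hr p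
    (hm.indicator hS)] at h1
  rw [lintegral_const_mul _ (by fun_prop), ← lintegral_indicator hS]
  simp only [Set.indicator_mul_right] at h1 ⊢
  rw [h1, ← ENNReal.ofReal_mul (mul_nonneg (hr_pos _).le (Real.exp_pos _).le), Halpha]
  congr 1
  ring

variable [IsProbabilityMeasure η]

/-- The total weight in the bias of the offspring cancels the normalization of the choice of the
child: `(W / H) · (w_j / W) = w_j / H`. -/
theorem lintegral_spineKernel {H : Sph d × ℝ → ℝ} (hH : Measurable H) {B : Set ℝ}
    (hB : MeasurableSet B) {p : Sph d × ℝ} (hp : 0 < H p)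
    (hmass : ∫⁻ c, totalWeight H B p c ∂η = ENNReal.ofReal (H p))
    {F : Config d × ℕ → ℝ≥0∞} (hF : Measurable F) :
    ∫⁻ a, F a ∂spineKernel η H B p =
      ∫⁻ c, ∑' j, childWeight H B p c j * F (c, j) / ENNReal.ofReal (H p) ∂η := by
  have hp0 : ENNReal.ofReal (H p) ≠ 0 := (ENNReal.ofReal_pos.2 hp).ne'
  have hpt : ENNReal.ofReal (H p) ≠ ∞ := ENNReal.ofReal_ne_top
  have htw : Measurable fun c => totalWeight H B p c :=
    (measurable_totalWeight hH hB).comp (measurable_const.prodMk measurable_id)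
  have hf1 : Measurable (Function.uncurry fun (p : Sph d × ℝ) (c : Config d) =>
      totalWeight H B p c / ENNReal.ofReal (H p)) :=
    (measurable_totalWeight hH hB).div (hH.comp measurable_fst).ennreal_ofReal
  have hf2 : Measurable (Function.uncurry fun (q : (Sph d × ℝ) × Config d) (j : ℕ) =>
      childWeight H B q.1 q.2 j / totalWeight H B q.1 q.2) :=
    measurable_from_prod_countable_left fun j =>
      (measurable_childWeight hH hB j).div (measurable_totalWeight hH hB)
  have hm1 : ∫⁻ c, totalWeight H B p c / ENNReal.ofReal (H p) ∂η = 1 := by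
    simp only [div_eq_mul_inv]
    rw [lintegral_mul_const _ htw, hmass, ENNReal.mul_inv_cancel hp0 hpt]
  -- The mean of `W` is `H p`, so `W` is finite almost surely; this is needed to cancel `W`.
  have hfin : ∀ᵐ c ∂η, totalWeight H B p c < ∞ :=
    ae_lt_top htw (by rw [hmass]; exact hpt)
  have : IsMarkovKernel (spineChoice (d := d) H B) := by unfold spineChoice; infer_instance
  have : IsMarkovKernel (sizeBiasedOffspring η H B) := by
    unfold sizeBiasedOffspring; infer_instance
  rw [spineKernel, Kernel.lintegral_compProd _ _ _ hF, sizeBiasedOffspring]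
  refine (lintegral_densityKernel η hf1 _ hm1
      (Measurable.lintegral_kernel_prod_right'
        (κ := (spineChoice H B).comap (fun c => (p, c)) measurable_prodMk_left) hF)).trans ?_
  refine lintegral_congr_ae ?_
  filter_upwards [hfin] with c hc
  by_cases h0 : totalWeight H B p c = 0
  -- If `W = 0`, all the `w_j` vanish, and both sides are zero whatever default label is chosen.
  · have : ∀ j, childWeight H B p c j = 0 := ENNReal.tsum_eq_zero.1 h0
    simp [h0, this]
  · have hm2 : ∫⁻ j, childWeight H B p c j / totalWeight H B p c ∂Measure.count = 1 := by
      rw [lintegral_count]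
      simp only [div_eq_mul_inv]
      rw [ENNReal.tsum_mul_right]
      exact ENNReal.mul_inv_cancel h0 hc.ne
    rw [Kernel.comap_apply]
    rw [spineChoice, lintegral_densityKernel _ hf2 _ hm2 (by fun_prop), lintegral_count,
      ← ENNReal.tsum_mul_left]
    refine tsum_congr fun j => ?_
    simp only [div_eq_mul_inv]
    calc _ = (totalWeight H B p c * (totalWeight H B p c)⁻¹) *
          (childWeight H B p c j * F (c, j) * (ENNReal.ofReal (H p))⁻¹) := by ring
      _ = _ := by rw [ENNReal.mul_inv_cancel h0 hc.ne, one_mul]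

end SpineKernel

/-! ## Resampling one coordinate -/

/-- Replacing one coordinate by an independent copy preserves the product measure, as is seen on
finite boxes. This form of independence drives both inductions over generations. -/
theorem lintegral_infinitePi_update {ι E : Type*} [DecidableEq ι] [MeasurableSpace E]
    (ν : Measure E) [IsProbabilityMeasure ν] (i : ι) {F : (ι → E) → ℝ≥0∞} (hF : Measurable F) :
    ∫⁻ ω, ∫⁻ c, F (Function.update ω i c) ∂ν ∂Measure.infinitePi (fun _ : ι => ν) =
      ∫⁻ ω, F ω ∂Measure.infinitePi (fun _ : ι => ν) := by
  have hu : Measurable fun q : (ι → E) × E => Function.update q.1 i q.2 := by fun_prop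
  have hmap : ((Measure.infinitePi fun _ : ι => ν).prod ν).map
      (fun q : (ι → E) × E => Function.update q.1 i q.2) = Measure.infinitePi fun _ : ι => ν := by
    refine Measure.eq_infinitePi _ fun s t ht => ?_
    have hs : MeasurableSet (Set.pi (s : Set ι) t) :=
      MeasurableSet.pi s.countable_toSet fun i _ => ht i
    rw [Measure.map_apply hu hs]
    by_cases hi : i ∈ s
    · have : (fun q : (ι → E) × E => Function.update q.1 i q.2) ⁻¹' Set.pi (s : Set ι) t =
          (Set.pi ((s.erase i : Finset ι) : Set ι) t) ×ˢ t i := by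
        ext q
        simp only [Set.mem_preimage, Set.mem_pi, Finset.mem_coe, Set.mem_prod, Finset.mem_erase]
        constructor
        · intro h
          refine ⟨fun k hk => ?_, by simpa using h i hi⟩
          simpa [hk.1] using h k hk.2
        · rintro ⟨h, h'⟩ k hk
          by_cases hki : k = i
          · subst hki; simpa using h'
          · simpa [hki] using h k ⟨hki, hk⟩
      rw [this, Measure.prod_prod, Measure.infinitePi_pi _ fun i _ => ht i,
        Finset.prod_erase_mul _ _ hi]
    · have : (fun q : (ι → E) × E => Function.update q.1 i q.2) ⁻¹' Set.pi (s : Set ι) t =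
          (Set.pi (s : Set ι) t) ×ˢ Set.univ := by
        ext q
        simp only [Set.mem_preimage, Set.mem_pi, Finset.mem_coe, Set.mem_prod, Set.mem_univ,
          and_true]
        refine forall_congr' fun k => forall_congr' fun hk => ?_
        rw [Function.update_of_ne (by rintro rfl; exact hi hk)]
      rw [this, Measure.prod_prod, Measure.infinitePi_pi _ fun i _ => ht i, measure_univ, mul_one]
  conv_rhs => rw [← hmap]
  rw [lintegral_map hF hu]
  exact (lintegral_prod _ (hF.comp hu).aemeasurable).symm

/-! ## The spine -/

section SpineLabels

theorem spineTake_zero (w : ℕ → ℕ) : spineTake w 0 = [] := rfl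

theorem spineTake_succ (w : ℕ → ℕ) (n : ℕ) : spineTake w (n + 1) = spineTake w n ++ [w n] := by
  simp [spineTake, List.range_succ]

@[simp]
theorem length_spineTake (w : ℕ → ℕ) (n : ℕ) : (spineTake w n).length = n := by
  simp [spineTake]

theorem getElem_spineTake (w : ℕ → ℕ) {n k : ℕ} (hk : k < (spineTake w n).length) :
    (spineTake w n)[k] = w k := by
  simp [spineTake]

theorem take_spineTake (w : ℕ → ℕ) {k n : ℕ} (hk : k ≤ n) :
    (spineTake w n).take k = spineTake w k := by
  simp [spineTake, ← List.map_take, List.take_range, min_eq_left hk]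

theorem spineTake_congr {w w' : ℕ → ℕ} {n : ℕ} (h : ∀ k < n, w k = w' k) :
    spineTake w n = spineTake w' n :=
  List.map_congr_left fun k hk => h k (List.mem_range.1 hk)

theorem measurableSet_spineTake_eq (n : ℕ) (z : List ℕ) :
    MeasurableSet {w : ℕ → ℕ | spineTake w n = z} := by
  induction n generalizing z with
  | zero => simp only [spineTake_zero]; exact MeasurableSet.const _
  | succ n ih =>
    rcases z.eq_nil_or_concat with rfl | ⟨v, j, rfl⟩
    · simp [spineTake_succ]
    · simp only [spineTake_succ, List.concat_eq_append, List.append_singleton_inj]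
      have h : MeasurableSet {w : ℕ → ℕ | w n = j} :=
        (measurable_pi_apply (X := fun _ : ℕ => ℕ) n) (measurableSet_singleton j)
      exact (ih v).inter h

end SpineLabels

/-! ### Grafting the spine into an environment -/

section SpineLaw

variable {d : ℕ}

/-- The matrix chosen in each step along the spine. -/
def spineMat (a : ℕ → Config d × ℕ) (k : ℕ) : Mat d := (a k).1.2 (a k).2

/-- The labels of the spine. -/
def spineLabel (a : ℕ → Config d × ℕ) (k : ℕ) : ℕ := (a k).2

theorem measurable_spineLabel : Measurable (spineLabel (d := d)) := by
  unfold spineLabel; fun_prop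

theorem actPos_spine (p : Sph d × ℝ) (a : ℕ → Config d × ℕ) (n : ℕ) :
    actPos (fun q : (Sph d × ℝ) × (Config d × ℕ) => step q.1 (q.2.1.2 q.2.2)) p a n =
      walk (p, spineMat a) n := by
  induction n with
  | zero => rw [walk_zero, actPos]
  | succ n ih => rw [walk_succ, actPos, ih]; rfl

theorem take_ne_of_lt {z : List ℕ} {k : ℕ} (hk : k < z.length) : z.take k ≠ z := fun h => by
  have := congrArg List.length h
  simp at this
  omega

theorem alive_update (B : Set ℝ) (ω : Env d) (p : Sph d × ℝ) (z : List ℕ) (c : Config d) :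
    Alive B (Function.update ω z c, p) z ↔ Alive B (ω, p) z :=
  alive_congr B fun _ hk => Function.update_of_ne (take_ne_of_lt hk) _ _

theorem node_update (ω : Env d) (p : Sph d × ℝ) (z : List ℕ) (c : Config d) :
    (X (Function.update ω z c, p) z, S (Function.update ω z c, p) z) =
      (X (ω, p) z, S (ω, p) z) :=
  node_congr fun _ hk => Function.update_of_ne (take_ne_of_lt hk) _ _

variable (η : Measure (Config d))

/-- The law of the environment. -/
noncomputable def envLaw : Measure (Env d) := Measure.infinitePi fun _ : List ℕ => η

theorem lintegral_lawP (x : Sph d) (b : ℝ) {f : Omega1 d → ℝ≥0∞} (hf : Measurable f) :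
    ∫⁻ ω, f ω ∂lawP η x b = ∫⁻ ω, f (ω, (x, b)) ∂envLaw η := by
  rw [lawP, lintegral_prod _ hf.aemeasurable]
  exact lintegral_congr fun ω => lintegral_dirac' _ (hf.comp measurable_prodMk_left)

variable [IsProbabilityMeasure η]

instance : IsProbabilityMeasure (envLaw η) := by unfold envLaw; infer_instance

instance (x : Sph d) (b : ℝ) : IsProbabilityMeasure (lawP η x b) := by
  unfold lawP; infer_instance

/-- The law of the offspring configurations and labels along the spine. -/
noncomputable def spineActLaw (H : Sph d × ℝ → ℝ) (B : Set ℝ) (p : Sph d × ℝ) :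
    Measure (ℕ → Config d × ℕ) :=
  actionLaw (spineKernel η H B) (fun q => step q.1 (q.2.1.2 q.2.2)) measurable_spineNext p

instance (H : Sph d × ℝ → ℝ) (B : Set ℝ) (p : Sph d × ℝ) :
    IsProbabilityMeasure (spineActLaw η H B p) := by
  unfold spineActLaw; infer_instance

open Classical in
/-- The environment in which the ancestors of `z` have the configurations of the sequence `a`. -/
noncomputable def graft (z : List ℕ) (a : ℕ → Config d × ℕ) (ω : Env d) : Env d := fun u =>
  if u.length < z.length ∧ u = z.take u.length then (a u.length).1 else ω u

theorem measurable_graft (z : List ℕ) :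
    Measurable fun q : (ℕ → Config d × ℕ) × Env d => graft z q.1 q.2 := by
  refine measurable_pi_lambda _ fun u => ?_
  unfold graft
  split_ifs <;> fun_prop

/-- Lengthening the branch by one letter overwrites only the configuration at `z`. Thus a step of
the spine chain becomes a resampling at `z`. -/
theorem graft_append (z : List ℕ) (j : ℕ) (a : ℕ → Config d × ℕ) (c : Config d × ℕ) (ω : Env d) :
    graft (z ++ [j]) (Function.update a z.length c) ω = Function.update (graft z a ω) z c.1 := by
  ext1 u
  unfold graft
  by_cases hu : u = z
  · subst hu
    simp
  · rw [Function.update_of_ne hu]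
    by_cases h : u.length < z.length
    · rw [List.take_append_of_le_length h.le, Function.update_of_ne h.ne]
      simp [h, h.trans (Nat.lt_succ_self _)]
    · have h1 : ¬ (u.length < (z ++ [j]).length ∧ u = (z ++ [j]).take u.length) := by
        rintro ⟨h1, h2⟩
        have : u.length = z.length := by simp at h1; omega
        rw [this, List.take_left] at h2
        exact hu h2
      rw [if_neg h1, if_neg fun h' => h h'.1]

theorem gMat_take_succ (ω : Env d) (z : List ℕ) {k : ℕ} (hk : k < z.length) :
    gMat ω (z.take (k + 1)) = (ω (z.take k)).2 z[k] := by
  rw [← List.take_append_getElem hk, gMat_append]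

/-- When the labels in `a` spell `z`, the matrix on each edge towards `z` in the grafted environment
is the one chosen by the spine. -/
theorem node_graft (p : Sph d × ℝ) {z : List ℕ} {a : ℕ → Config d × ℕ} (ω : Env d)
    (hz : spineTake (spineLabel a) z.length = z) :
    (X (graft z a ω, p) z, S (graft z a ω, p) z) = walk (p, spineMat a) z.length := by
  rw [node_eq_walk]
  refine walk_congr fun k hk => ?_
  have hk' : k < (spineTake (spineLabel a) z.length).length := by rwa [hz]
  have h1 := getElem_spineTake _ hk'
  simp only [hz] at h1
  rw [branchPath, gMat_take_succ _ _ hk, h1]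
  change (graft z a ω (z.take k)).2 _ = _
  unfold graft
  rw [if_pos]
  · simp [min_eq_left hk.le, spineMat, spineLabel]
  · simp [min_eq_left hk.le, hk]

open Classical in
/-- The spine process up to generation `|z|` on the event that the spine runs through `z`. -/
theorem lintegral_graft {H : Sph d × ℝ → ℝ} (hH : Measurable H) {B : Set ℝ}
    (hB : MeasurableSet B)
    (hmass : ∀ p : Sph d × ℝ, p.2 ∈ B → 0 < H p ∧
      ∫⁻ c, totalWeight H B p c ∂η = ENNReal.ofReal (H p))
    {p : Sph d × ℝ} (hp : p.2 ∈ B) (z : List ℕ) {F : Env d → ℝ≥0∞} (hF : Measurable F) :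
    ∫⁻ ω, ∫⁻ a, (if spineTake (spineLabel a) z.length = z then F (graft z a ω) else 0)
        ∂spineActLaw η H B p ∂envLaw η =
      ∫⁻ ω, F ω * nodeTerm H B (ω, p) z / ENNReal.ofReal (H p) ∂envLaw η := by
  induction z using List.reverseRecOn generalizing F with
  | nil =>
    have h0 : ENNReal.ofReal (H p) ≠ 0 := (ENNReal.ofReal_pos.2 (hmass p hp).1).ne'
    refine lintegral_congr fun ω => ?_
    have h1 : ∀ a : ℕ → Config d × ℕ, graft [] a ω = ω := fun a => by ext1 u; simp [graft]
    have h2 : (X (ω, p) [], S (ω, p) []) = p := by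
      rw [node_eq_walk, List.length_nil, walk_zero]
    have h3 : Alive B (ω, p) [] := by
      rw [alive_iff_walk]
      refine ⟨inTree_nil _, fun k hk => ?_⟩
      rw [Nat.le_zero.1 hk, walk_zero]
      exact hp
    simp only [List.length_nil, spineTake_zero, if_true, h1, lintegral_const, measure_univ, mul_one]
    rw [nodeTerm_eq, if_pos h3, h2, mul_div_assoc, ENNReal.div_self h0 ENNReal.ofReal_ne_top,
      mul_one]
  | append_singleton z j ih =>
    have hsp : ∀ a : ℕ → Config d × ℕ, (spineTake (spineLabel a) (z ++ [j]).length = z ++ [j]) ↔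
        spineTake (spineLabel a) z.length = z ∧ (a z.length).2 = j := fun a => by
      rw [List.length_append, List.length_singleton, spineTake_succ, List.append_singleton_inj]
      rfl
    have hupd : ∀ (a : ℕ → Config d × ℕ) c, spineTake
        (spineLabel (Function.update a z.length c)) z.length = spineTake (spineLabel a) z.length :=
      fun a c => spineTake_congr fun k hk => by simp [spineLabel, hk.ne]
    have hset : ∀ y : List ℕ, MeasurableSet
        {a : ℕ → Config d × ℕ | spineTake (spineLabel a) y.length = y} := fun y =>
      measurable_spineLabel (measurableSet_spineTake_eq _ _)
    -- The average of `F` over the last step of the spine. The position of `z` is read off from the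
    -- environment, so `F'` is again a function of the environment, and the induction hypothesis
    -- applies to it.
    let F' : Env d → ℝ≥0∞ := fun ω => ∫⁻ c, (if c.2 = j then F (Function.update ω z c.1) else 0)
      ∂spineKernel η H B (X (ω, p) z, S (ω, p) z)
    have hF' : Measurable F' := by
      refine Measurable.lintegral_kernel_prod_right'
        (κ := (spineKernel η H B).comap (fun ω : Env d => (X (ω, p) z, S (ω, p) z))
          ((measurable_node z).comp measurable_prodMk_right))
        (f := fun q : Env d × (Config d × ℕ) => if q.2.2 = j then F (Function.update q.1 z q.2.1)
          else 0) ?_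
      exact Measurable.ite (measurable_snd.snd (measurableSet_singleton j)) (by fun_prop)
        measurable_const
    have hstep : ∀ ω : Env d, ∫⁻ a, (if spineTake (spineLabel a) (z ++ [j]).length = z ++ [j] then
        F (graft (z ++ [j]) a ω) else 0) ∂spineActLaw η H B p =
        ∫⁻ a, (if spineTake (spineLabel a) z.length = z then F' (graft z a ω) else 0)
          ∂spineActLaw η H B p := by
      intro ω
      refine (lintegral_actionLaw_update _ _ _ z.length ?_ ?_).trans
        (lintegral_congr fun a => ?_)
      · exact Measurable.ite (hset _)
          (hF.comp ((measurable_graft _).comp measurable_prodMk_right)) measurable_const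
      · intro a a' h
        have h1 : spineTake (spineLabel a) z.length = spineTake (spineLabel a') z.length :=
          spineTake_congr fun k hk => by simp only [spineLabel, h k hk.le]
        have h2 : graft (z ++ [j]) a ω = graft (z ++ [j]) a' ω := by
          ext1 u
          unfold graft
          split_ifs with hu
          · rw [h u.length (by have := hu.1; simp at this; omega)]
          · rfl
        simp only [hsp, h1, h2, h z.length le_rfl]
      · simp only [hsp, hupd, Function.update_self, graft_append, actPos_spine]
        split_ifs with h
        · simp only [h, true_and]
          rw [← node_graft p ω h]
        · simp [h]
    simp only [hstep]
    have hG : Measurable fun ω : Env d =>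
        F ω * nodeTerm H B (ω, p) (z ++ [j]) / ENNReal.ofReal (H p) :=
      (hF.mul ((measurable_nodeTerm hH hB _).comp measurable_prodMk_right)).div_const _
    rw [ih hF']
    -- The configuration at `z` is resampled on the right-hand side, to match the average contained
    -- in `F'`.
    refine Eq.trans (lintegral_congr fun ω => ?_) (lintegral_infinitePi_update η z hG)
    simp only [nodeTerm_append, alive_update, node_update, Function.update_self]
    rw [nodeTerm_eq]
    split_ifs with h
    · have hS : S (ω, p) z ∈ B := by simpa using h.2 z.length le_rfl
      have hq := hmass (X (ω, p) z, S (ω, p) z) hS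
      set q : Sph d × ℝ := (X (ω, p) z, S (ω, p) z) with hqdef
      have h0 : ENNReal.ofReal (H q) ≠ 0 := (ENNReal.ofReal_pos.2 hq.1).ne'
      have hcw : Measurable fun c => childWeight H B q c j :=
        (measurable_childWeight hH hB j).comp measurable_prodMk_left
      have hint : F' ω = (∫⁻ c, F (Function.update ω z c) * childWeight H B q c j ∂η) /
          ENNReal.ofReal (H q) := by
        refine (lintegral_spineKernel η hH hB hq.1 hq.2 ?_).trans ?_
        · exact Measurable.ite (measurable_snd (measurableSet_singleton j)) (by fun_prop)
            measurable_const
        · simp only [div_eq_mul_inv]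
          rw [← lintegral_mul_const _ (by fun_prop)]
          refine lintegral_congr fun c => ?_
          rw [tsum_eq_single j fun i hi => by simp [hi], if_pos rfl, mul_comm (F _)]
      -- The telescoping: the weight `H q` of `z` cancels the denominator of the last step.
      rw [hint, ENNReal.div_mul_cancel h0 ENNReal.ofReal_ne_top]
      simp only [div_eq_mul_inv]
      rw [← lintegral_mul_const _ (by fun_prop)]
    · simp

end SpineLaw

/-! ## The many-to-one formula -/

theorem tsum_length_zero (T : List ℕ → ℝ≥0∞) : ∑' u : {u : List ℕ // u.length = 0}, T u = T [] := by
  refine tsum_eq_single (⟨[], rfl⟩ : {u : List ℕ // u.length = 0}) fun u hu => ?_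
  exact absurd (Subtype.ext (List.length_eq_zero_iff.1 u.2)) hu

theorem tsum_length_succ (n : ℕ) (T : List ℕ → ℝ≥0∞) :
    ∑' u : {u : List ℕ // u.length = n + 1}, T u =
      ∑' u : {u : List ℕ // u.length = n}, ∑' j : ℕ, T (u.1 ++ [j]) := by
  let e : {u : List ℕ // u.length = n} × ℕ → {u : List ℕ // u.length = n + 1} :=
    fun q => ⟨q.1.1 ++ [q.2], by simp [q.1.2]⟩
  have he : Function.Bijective e := by
    constructor
    · rintro ⟨⟨u, hu⟩, j⟩ ⟨⟨v, hv⟩, k⟩ h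
      have h' : u ++ [j] = v ++ [k] := congrArg Subtype.val h
      obtain ⟨rfl, rfl⟩ := List.append_singleton_inj.1 h'
      rfl
    · rintro ⟨u, hu⟩
      rcases u.eq_nil_or_concat with rfl | ⟨v, j, rfl⟩
      · simp at hu
      · exact ⟨(⟨v, by simpa using hu⟩, j), Subtype.ext (by simp [e])⟩
  rw [← (Equiv.ofBijective e he).tsum_eq]
  exact ENNReal.tsum_prod (f := fun (u : {u : List ℕ // u.length = n}) j => T (u.1 ++ [j]))

section ManyToOne

variable {d : ℕ} (η : Measure (Config d)) [IsProbabilityMeasure η] {α : ℝ} {r : Sph d → ℝ}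

/-- The expectation of a functional of the walk as an expectation over the branches of the tree. -/
theorem lintegral_matLaw_eq_tsum (hr_meas : Measurable r) (hr_pos : ∀ x, 0 < r x)
    (hr : ∀ x, transferOp η α r x = r x) (p : Sph d × ℝ) (n : ℕ) {F : (ℕ → Mat d) → ℝ≥0∞}
    (hF : Measurable F) (hdep : ∀ a a' : ℕ → Mat d, (∀ k < n, a k = a' k) → F a = F a') :
    ∫⁻ a, F a ∂matLaw η α r p = (ENNReal.ofReal (Halpha α r (fun _ => 1) p))⁻¹ *
      ∑' u : {u : List ℕ // u.length = n}, ∫⁻ ω, nodeTerm (Halpha α r fun _ => 1) Set.univ (ω, p) u *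
        F (branchPath ω u) ∂envLaw η := by
  classical
  have hH1 : Measurable (Halpha α r fun _ : Sph d × ℝ => 1) :=
    measurable_Halpha hr_meas measurable_const
  set H₁ : Sph d × ℝ → ℝ := Halpha α r fun _ => 1 with hH₁
  induction n generalizing F with
  | zero =>
    have hp : 0 < H₁ p := by
      have := hr_pos p.1
      simp only [hH₁, Halpha]; positivity
    have h1 : ∀ a, F a = F fun _ => 1 := fun a => hdep _ _ fun k hk => absurd hk (Nat.not_lt_zero k)
    have h2 : ∀ ω : Env d, nodeTerm H₁ Set.univ (ω, p) [] = ENNReal.ofReal (H₁ p) := fun ω => by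
      rw [nodeTerm_eq, if_pos ⟨inTree_nil _, fun _ _ => Set.mem_univ _⟩, node_eq_walk,
        List.length_nil, walk_zero]
    rw [tsum_length_zero fun u => ∫⁻ ω, nodeTerm H₁ Set.univ (ω, p) u *
        F (branchPath ω u) ∂envLaw η]
    simp only [h2]
    simp only [h1, lintegral_const, measure_univ, mul_one]
    rw [h1 fun _ => _, ← mul_assoc, ENNReal.inv_mul_cancel (ENNReal.ofReal_pos.2 hp).ne'
      ENNReal.ofReal_ne_top, one_mul]
  | succ n ih =>
    -- The last matrix is averaged given the first `n`; `F'` depends on these only, as the induction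
    -- hypothesis requires.
    let F' : (ℕ → Mat d) → ℝ≥0∞ := fun a =>
      ∫⁻ g, F (Function.update a n g) ∂walkKernel η α r (walk (p, a) n)
    have hF' : Measurable F' :=
      Measurable.lintegral_kernel_prod_right'
        (κ := (walkKernel η α r).comap (fun a : ℕ → Mat d => walk (p, a) n)
          ((measurable_walk n).comp measurable_prodMk_left))
        (f := fun q : (ℕ → Mat d) × Mat d => F (Function.update q.1 n q.2)) (by fun_prop)
    have hdep' : ∀ a a' : ℕ → Mat d, (∀ k < n, a k = a' k) → F' a = F' a' := by
      intro a a' h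
      simp only [F', walk_congr h]
      refine lintegral_congr fun g => hdep _ _ fun k hk => ?_
      rcases Nat.lt_succ_iff_lt_or_eq.1 hk with hk | rfl
      · rw [Function.update_of_ne hk.ne, Function.update_of_ne hk.ne, h k hk]
      · simp
    rw [lintegral_matLaw_update η p n hF fun a a' h => hdep _ _ fun k hk => h k (by omega)]
    refine (ih hF' hdep').trans ?_
    rw [tsum_length_succ n fun u => ∫⁻ ω, nodeTerm H₁ Set.univ (ω, p) u *
        F (branchPath ω u) ∂envLaw η]
    congr 1
    refine tsum_congr fun u => ?_
    obtain ⟨z, rfl⟩ := u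
    have hG : ∀ j, Measurable fun ω : Env d => nodeTerm H₁ Set.univ (ω, p) (z ++ [j]) *
        F (branchPath ω (z ++ [j])) := fun j =>
      ((measurable_nodeTerm hH1 MeasurableSet.univ _).comp measurable_prodMk_right).mul
        (hF.comp (measurable_branchPath _))
    rw [← lintegral_tsum fun j => (hG j).aemeasurable]
    refine Eq.trans (lintegral_congr fun ω => ?_)
      (lintegral_infinitePi_update η z (Measurable.tsum hG))
    have hbp : ∀ (c : Config d) j, F (branchPath (Function.update ω z c) (z ++ [j])) =
        F (Function.update (branchPath ω z) z.length (c.2 j)) := fun c j =>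
      hdep _ _ fun k hk => by
        rcases Nat.lt_succ_iff_lt_or_eq.1 hk with hk | rfl
        · rw [branchPath_append_of_lt _ _ _ hk, Function.update_of_ne hk.ne,
            branchPath_congr fun k hk => Function.update_of_ne (take_ne_of_lt hk) _ _]
        · rw [branchPath_append_length, Function.update_self, Function.update_self]
    simp only [nodeTerm_append, alive_update, node_update, Function.update_self, hbp]
    rw [nodeTerm_eq]
    split_ifs with h
    · have hq : walk (p, branchPath ω z) z.length = (X (ω, p) z, S (ω, p) z) :=
        (node_eq_walk (ω, p) z).symm
      set q : Sph d × ℝ := (X (ω, p) z, S (ω, p) z)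
      have hd : Measurable (walkDensity α r q) := (measurable_walkDensity hr_meas).of_uncurry_left
      have hFu : Measurable fun g => F (Function.update (branchPath ω z) z.length g) := by fun_prop
      have hcw : ∀ j, Measurable fun c => childWeight H₁ Set.univ q c j := fun j =>
        (measurable_childWeight hH1 MeasurableSet.univ j).comp measurable_prodMk_left
      simp only [F', hq]
      have hdF : Measurable fun g => walkDensity α r q g *
          F (Function.update (branchPath ω z) z.length g) := hd.mul hFu
      rw [lintegral_walkKernel η hr_meas hr_pos hr q hFu, lintegral_intensity η hdF,
        ← ENNReal.tsum_mul_left, lintegral_tsum]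
      swap
      · exact fun j => ((hcw j).mul (hFu.comp (measurable_configMat j))).aemeasurable
      refine tsum_congr fun j => ?_
      have hdFj : Measurable fun c : Config d => walkDensity α r q (c.2 j) *
          F (Function.update (branchPath ω z) z.length (c.2 j)) :=
        hdF.comp (measurable_configMat j)
      rw [← lintegral_const_mul _ hdFj, ← lintegral_indicator (measurableSet_lt_config j)]
      refine lintegral_congr fun c => ?_
      by_cases hj : (j : ℕ∞) < c.1
      · have hstep := Halpha_step (α := α) hr_pos (fun _ => 1) q (c.2 j)
        have hq1 : H₁ q = r q.1 * Real.exp (-α * q.2) := by simp [hH₁, Halpha]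
        rw [Set.indicator_of_mem (by exact hj), childWeight, if_pos ⟨hj, Set.mem_univ _⟩, hstep, hq1,
          ENNReal.ofReal_one, mul_one, mul_assoc]
      · simp [childWeight, hj]
    · simp

/-- The many-to-one formula for the law `ℚ_{x,b}^α`. -/
theorem lintegral_lawQ_eq (hr_meas : Measurable r) (hr_pos : ∀ x, 0 < r x)
    (hr : ∀ x, transferOp η α r x = r x) (x : Sph d) (b : ℝ) (n : ℕ)
    {f : (Fin n → Mat d) → ℝ≥0∞} (hf : Measurable f) :
    ∫⁻ q, f (fun i => q.2 i) ∂(lawQ η α r x b) = ENNReal.ofReal (Real.exp (α * b) / r x) *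
      ∫⁻ ω, ∑' u : {u : List ℕ // u.length = n},
        nodeTerm (Halpha α r fun _ => 1) Set.univ ω u *
          f (fun i => gMat ω.1 (u.1.take (i + 1))) ∂(lawP η x b) := by
  have hH1 : Measurable (Halpha α r fun _ : Sph d × ℝ => 1) :=
    measurable_Halpha hr_meas measurable_const
  have hm : ∀ u : {u : List ℕ // u.length = n}, Measurable fun ω : Omega1 d =>
      nodeTerm (Halpha α r fun _ => 1) Set.univ ω u *
        f (fun i => gMat ω.1 (u.1.take (i + 1))) := fun u =>
    (measurable_nodeTerm hH1 MeasurableSet.univ _).mul (hf.comp (measurable_pi_lambda _ fun i =>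
      (measurable_gMat _).comp measurable_fst))
  have hx := hr_pos x
  rw [lintegral_lawQ η x b (by fun_prop), lintegral_tsum fun u => (hm u).aemeasurable]
  simp only [lintegral_lawP η x b (hm _)]
  rw [lintegral_matLaw_eq_tsum η hr_meas hr_pos hr (x, b) n (F := fun a => f fun i => a i)
    (by fun_prop) fun a a' h => by simp only [h _ (Fin.is_lt _)]]
  congr 1
  rw [← ENNReal.ofReal_inv_of_pos (by simp only [Halpha]; positivity)]
  congr 1
  simp only [Halpha, neg_mul, Real.exp_neg]
  field_simp

end ManyToOne

/-! ## The law of the process with a spine -/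

section LawSpine

variable {d : ℕ} (η : Measure (Config d)) [IsProbabilityMeasure η]

open Classical in
/-- The environment and the spine given by the moves along the spine and an independent
environment for the other nodes. -/
noncomputable def assembleMoves (p : Sph d × ℝ) (q : (ℕ → Config d × ℕ) × Env d) : Omega2 d :=
  ((fun u => if u = spineTake (spineLabel q.1) u.length then (q.1 u.length).1 else q.2 u, p),
    spineLabel q.1)

theorem measurable_assembleMoves (p : Sph d × ℝ) : Measurable (assembleMoves (d := d) p) := by
  classical
  refine Measurable.prodMk (Measurable.prodMk (measurable_pi_lambda _ fun u => ?_)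
    measurable_const) (measurable_spineLabel.comp measurable_fst)
  have h : MeasurableSet {q : (ℕ → Config d × ℕ) × Env d |
      u = spineTake (spineLabel q.1) u.length} := by
    simp only [eq_comm (a := u)]
    exact measurable_spineLabel.comp measurable_fst (measurableSet_spineTake_eq _ _)
  exact Measurable.ite h (by fun_prop) (by fun_prop)

/-- The assembled tree uses only the moves of the chain, so the stored positions can be dropped. -/
theorem lawSpine_eq_map (H : Sph d × ℝ → ℝ) (B : Set ℝ) (x : Sph d) (b : ℝ) :
    lawSpine η H B x b =
      ((spineActLaw η H B (x, b)).prod (envLaw η)).map (assembleMoves (x, b)) := by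
  have h := Measure.map_prod_map (moveChain (spineKernel η H B)
    (fun q => step q.1 (q.2.1.2 q.2.2)) measurable_spineNext (x, b)) (envLaw η)
    measurable_moves measurable_id
  rw [Measure.map_id] at h
  rw [spineActLaw, actionLaw, h,
    Measure.map_map (measurable_assembleMoves _) (measurable_moves.prodMap measurable_id), lawSpine]
  rfl

instance (H : Sph d × ℝ → ℝ) (B : Set ℝ) (x : Sph d) (b : ℝ) :
    IsProbabilityMeasure (lawSpine η H B x b) := by
  rw [lawSpine_eq_map]
  exact Measure.isProbabilityMeasure_map (measurable_assembleMoves _).aemeasurable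

theorem measurableSet_spineTake_snd (n : ℕ) (z : List ℕ) :
    MeasurableSet {ω : Omega2 d | spineTake ω.2 n = z} :=
  measurable_snd (measurableSet_spineTake_eq n z)

/-- If the spine passes through `z`, the assembled and the grafted environments agree before
generation `|z|`, and `ℱ_{|z|}` sees nothing more. -/
theorem assembleMoves_mem_iff {p : Sph d × ℝ} {z : List ℕ} {A : Set (Omega1 d)}
    (hA : MeasurableSet[filtF d z.length] A) {a : ℕ → Config d × ℕ} {ω : Env d}
    (hz : spineTake (spineLabel a) z.length = z) :
    (assembleMoves p (a, ω)).1 ∈ A ↔ (graft z a ω, p) ∈ A := by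
  refine mem_congr_of_measurableSet_filtF hA fun u hu => ?_
  have : u = spineTake (spineLabel a) u.length ↔ u = z.take u.length := by
    rw [← hz, take_spineTake _ hu.le]
  simp only [graft, this, hu, true_and]

theorem lawSpine_apply {H : Sph d × ℝ → ℝ} (hH : Measurable H) {B : Set ℝ}
    (hB : MeasurableSet B)
    (hmass : ∀ p : Sph d × ℝ, p.2 ∈ B → 0 < H p ∧
      ∫⁻ c, totalWeight H B p c ∂η = ENNReal.ofReal (H p))
    {x : Sph d} {b : ℝ} (hb : b ∈ B) (z : List ℕ) {A : Set (Omega1 d)}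
    (hA : MeasurableSet[filtF d z.length] A) :
    lawSpine η H B x b (Prod.fst ⁻¹' A ∩ {ω | spineTake ω.2 z.length = z}) =
      (∫⁻ ω in A, nodeTerm H B ω z ∂lawP η x b) / ENNReal.ofReal (H (x, b)) := by
  classical
  have hA' : MeasurableSet A := filtF_le _ _ hA
  have hs : MeasurableSet (Prod.fst ⁻¹' A ∩ {ω : Omega2 d | spineTake ω.2 z.length = z}) :=
    (measurable_fst hA').inter (measurableSet_spineTake_snd _ _)
  have hAp : MeasurableSet ((fun ω : Env d => (ω, (x, b))) ⁻¹' A) := measurable_prodMk_right hA'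
  have hpre : MeasurableSet (assembleMoves (x, b) ⁻¹'
      (Prod.fst ⁻¹' A ∩ {ω : Omega2 d | spineTake ω.2 z.length = z})) :=
    measurable_assembleMoves _ hs
  rw [lawSpine_eq_map, Measure.map_apply (measurable_assembleMoves _) hs,
    ← lintegral_indicator_one hpre, lintegral_prod_symm _
      (measurable_one.indicator hpre).aemeasurable]
  have hF : Measurable (((fun ω : Env d => (ω, (x, b))) ⁻¹' A).indicator (1 : Env d → ℝ≥0∞)) :=
    measurable_one.indicator hAp
  have key := lintegral_graft η hH hB hmass (p := (x, b)) hb z hF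
  refine Eq.trans (lintegral_congr fun ω => lintegral_congr fun a => ?_) (key.trans ?_)
  · by_cases hz : spineTake (spineLabel a) z.length = z
    · rw [if_pos hz]
      have h1 := assembleMoves_mem_iff (p := (x, b)) hA (ω := ω) hz
      have h2 : (a, ω) ∈ assembleMoves (x, b) ⁻¹'
          (Prod.fst ⁻¹' A ∩ {ω : Omega2 d | spineTake ω.2 z.length = z}) ↔
          graft z a ω ∈ (fun ω : Env d => (ω, (x, b))) ⁻¹' A :=
        (and_iff_left hz).trans h1
      simp only [Set.indicator_apply, h2]
      rfl
    · rw [if_neg hz, Set.indicator_of_notMem]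
      exact fun h => hz h.2
  · have hn : Measurable fun ω : Omega1 d => nodeTerm H B ω z := measurable_nodeTerm hH hB z
    rw [← lintegral_indicator hA', lintegral_lawP η x b (hn.indicator hA')]
    simp only [div_eq_mul_inv]
    rw [lintegral_mul_const _ (by fun_prop)]
    congr 1
    refine lintegral_congr fun ω => ?_
    by_cases h : (ω, (x, b)) ∈ A <;> simp [Set.indicator, h]

end LawSpine

/-! ## Characterization of the size-biased law with a spine -/

theorem lintegral_eq_of_eq_on_measurableSet {Ω : Type*} {m m0 : MeasurableSpace Ω} (hm : m ≤ m0)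
    {μ ν : Measure Ω} (h : ∀ A, MeasurableSet[m] A → μ A = ν A) {φ : Ω → ℝ≥0∞}
    (hφ : Measurable[m] φ) : ∫⁻ ω, φ ω ∂μ = ∫⁻ ω, φ ω ∂ν := by
  have : μ.trim hm = ν.trim hm := by
    refine @Measure.ext _ m _ _ fun A hA => ?_
    rw [trim_measurableSet_eq hm hA, trim_measurableSet_eq hm hA, h A hA]
  rw [← lintegral_trim hm hφ, ← lintegral_trim hm hφ, this]

section Characterization

variable {d : ℕ} {η : Measure (Config d)} {H : Sph d × ℝ → ℝ} {B : Set ℝ} {x : Sph d} {b : ℝ}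

/-- The joint law of `ℱ_n` and of the first `n` letters of the spine. -/
def HasSpineDensity (η : Measure (Config d)) (H : Sph d × ℝ → ℝ) (B : Set ℝ) (x : Sph d) (b : ℝ)
    (Phat : Measure (Omega2 d)) : Prop :=
  ∀ (z : List ℕ) (A : Set (Omega1 d)), MeasurableSet[filtF d z.length] A →
    Phat (Prod.fst ⁻¹' A ∩ {ω | spineTake ω.2 z.length = z}) =
      (∫⁻ ω in A, nodeTerm H B ω z ∂lawP η x b) / ENNReal.ofReal (H (x, b))

theorem nodeTerm_le_martM (ω : Omega1 d) (z : List ℕ) :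
    nodeTerm H B ω z ≤ martM H B z.length ω :=
  ENNReal.le_tsum (f := fun u : {u : List ℕ // u.length = z.length} => nodeTerm H B ω u) ⟨z, rfl⟩

theorem nodeTerm_div_martM_le_one (ω : Omega1 d) (z : List ℕ) :
    nodeTerm H B ω z / martM H B z.length ω ≤ 1 :=
  ENNReal.div_le_of_le_mul (by rw [one_mul]; exact nodeTerm_le_martM ω z)

variable (hH : Measurable H) (hB : MeasurableSet B)

include hH hB in
theorem IsSizeBiased.lintegral_eq {Phat : Measure (Omega1 d)}
    (hP : IsSizeBiased η H B x b Phat) {n : ℕ} {φ : Omega1 d → ℝ≥0∞}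
    (hφ : Measurable[filtF d n] φ) :
    ∫⁻ ω, φ ω ∂Phat =
      (∫⁻ ω, martM H B n ω * φ ω ∂lawP η x b) / ENNReal.ofReal (H (x, b)) := by
  have hM := measurable_martM (d := d) hH hB n
  rw [lintegral_eq_of_eq_on_measurableSet (filtF_le n)
    (ν := (ENNReal.ofReal (H (x, b)))⁻¹ • (lawP η x b).withDensity (martM H B n)) ?_ hφ,
    lintegral_smul_measure, lintegral_withDensity_eq_lintegral_mul _ hM (hφ.mono (filtF_le n) le_rfl),
    smul_eq_mul, ENNReal.div_eq_inv_mul]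
  · rfl
  · intro A hA
    rw [hP.2 n A hA, Measure.smul_apply, withDensity_apply _ (filtF_le n _ hA), smul_eq_mul,
      ENNReal.div_eq_inv_mul]

include hH hB in
theorem IsSizeBiased.ae_martM_lt_top {Phat : Measure (Omega1 d)}
    (hP : IsSizeBiased η H B x b Phat) (n : ℕ) : ∀ᵐ ω ∂lawP η x b, martM H B n ω < ∞ := by
  refine ae_lt_top (measurable_martM hH hB n) fun htop => ?_
  have := hP.1
  -- The total mass of `Phat` is one, so `M_n` cannot have infinite mean.
  have h1 := hP.2 n Set.univ MeasurableSet.univ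
  rw [measure_univ, Measure.restrict_univ, htop, ENNReal.top_div_of_ne_top ENNReal.ofReal_ne_top]
    at h1
  exact ENNReal.one_ne_top h1

include hH hB in
theorem IsSizeBiased.setLIntegral_ratio {Phat : Measure (Omega1 d)}
    (hP : IsSizeBiased η H B x b Phat) (z : List ℕ) {A : Set (Omega1 d)}
    (hA : MeasurableSet[filtF d z.length] A) :
    ∫⁻ ω in A, nodeTerm H B ω z / martM H B z.length ω ∂Phat =
      (∫⁻ ω in A, nodeTerm H B ω z ∂lawP η x b) / ENNReal.ofReal (H (x, b)) := by
  have hA' : MeasurableSet A := filtF_le _ _ hA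
  rw [← lintegral_indicator hA', ← lintegral_indicator hA', hP.lintegral_eq hH hB (n := z.length)]
  · congr 1
    refine lintegral_congr_ae ?_
    filter_upwards [hP.ae_martM_lt_top hH hB z.length] with ω hω
    by_cases h : ω ∈ A
    · rw [Set.indicator_of_mem h, Set.indicator_of_mem h]
      -- Where `M_n = 0` the numerator vanishes too, so the undefined ratio is harmless.
      rcases eq_or_ne (martM H B z.length ω) 0 with h0 | h0
      · have := nodeTerm_le_martM (H := H) (B := B) ω z
        rw [h0] at this
        rw [h0, zero_mul, le_antisymm this zero_le]
      · exact ENNReal.mul_div_cancel h0 hω.ne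
    · simp [h]
  · exact Measurable.indicator (m := filtF d z.length) (((measurable_nodeTerm_filtF hH hB le_rfl).div
      (measurable_martM_filtF hH hB _))) hA

theorem comap_filtF_le (n : ℕ) :
    (filtF d n).comap Prod.fst ≤ (inferInstance : MeasurableSpace (Omega2 d)) := by
  rintro _ ⟨A, hA, rfl⟩
  exact measurable_fst (filtF_le n A hA)

include hH hB in
theorem measurable_ratio_comap (z : List ℕ) :
    Measurable[(filtF d z.length).comap Prod.fst] fun ω : Omega2 d =>
      nodeTerm H B ω.1 z / martM H B z.length ω.1 :=
  ((measurable_nodeTerm_filtF hH hB le_rfl).div (measurable_martM_filtF hH hB _)).comp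
    (comap_measurable Prod.fst)

include hH hB in
theorem measurable_ratio (z : List ℕ) : Measurable fun ω : Omega1 d =>
      nodeTerm H B ω z / martM H B z.length ω :=
  (measurable_nodeTerm hH hB z).div (measurable_martM hH hB _)

include hH hB in
theorem setIntegral_ratio {Phat : Measure (Omega2 d)}
    (hP : IsSizeBiased η H B x b (Phat.map Prod.fst)) (z : List ℕ) {A : Set (Omega1 d)}
    (hA : MeasurableSet[filtF d z.length] A) :
    ∫ ω in Prod.fst ⁻¹' A, (nodeTerm H B ω.1 z / martM H B z.length ω.1).toReal ∂Phat =
      ((∫⁻ ω in A, nodeTerm H B ω z ∂lawP η x b) / ENNReal.ofReal (H (x, b))).toReal := by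
  rw [integral_toReal, ← hP.setLIntegral_ratio hH hB z hA,
    setLIntegral_map (filtF_le _ _ hA) (measurable_ratio hH hB z) measurable_fst]
  · exact ((measurable_ratio hH hB z).comp measurable_fst).aemeasurable
  · exact Filter.Eventually.of_forall fun ω =>
      (nodeTerm_div_martM_le_one ω.1 z).trans_lt ENNReal.one_lt_top

include hH hB in
-- Integrating the conditional probability (1) over `A` and changing measure by `M_n` removes the
-- denominator `M_n`.
theorem IsSizeBiasedWithSpine.hasSpineDensity {Phat : Measure (Omega2 d)}
    (hP : IsSizeBiasedWithSpine η H B x b Phat) : HasSpineDensity η H B x b Phat := by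
  intro z A hA
  have := hP.1
  have hs := measurableSet_spineTake_snd (d := d) z.length z
  have h1 := setIntegral_condExp (comap_filtF_le z.length)
    ((integrable_const (1 : ℝ)).indicator hs (μ := Phat)) (s := Prod.fst ⁻¹' A) ⟨A, hA, rfl⟩
  have h2 := setIntegral_congr_ae (g := fun ω => (nodeTerm H B ω.1 z / martM H B z.length ω.1).toReal)
    (measurable_fst (filtF_le _ _ hA)) ((hP.2.2 _ z rfl).mono fun ω hω _ => hω)
  rw [setIntegral_ratio hH hB hP.2.1 z hA] at h2
  rw [setIntegral_indicator hs, setIntegral_const, smul_eq_mul, mul_one] at h1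
  have h3 := h1.symm.trans h2
  rw [Measure.real, ENNReal.toReal_eq_toReal_iff' (measure_ne_top _ _)] at h3
  · exact h3
  · rw [← hP.2.1.setLIntegral_ratio hH hB z hA]
    have := hP.2.1.1
    refine ((lintegral_mono fun ω => nodeTerm_div_martM_le_one ω z).trans_lt ?_).ne
    rw [lintegral_one]
    exact measure_lt_top _ _

theorem iUnion_spineTake (n : ℕ) :
    ⋃ u : {u : List ℕ // u.length = n}, {ω : Omega2 d | spineTake ω.2 n = u} = Set.univ :=
  Set.eq_univ_of_forall fun ω => Set.mem_iUnion.2 ⟨⟨spineTake ω.2 n, length_spineTake _ _⟩, rfl⟩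

theorem disjoint_spineTake (n : ℕ) : Pairwise (Function.onFun Disjoint
    fun u : {u : List ℕ // u.length = n} => {ω : Omega2 d | spineTake ω.2 n = u}) := by
  intro u v huv
  refine Set.disjoint_left.2 fun ω h h' => huv (Subtype.ext ?_)
  exact (show spineTake ω.2 n = u from h).symm.trans h'

/-- Decomposition of an integral according to the first letters of the spine. -/
theorem lintegral_eq_tsum_spineTake (Phat : Measure (Omega2 d)) (n : ℕ) (f : Omega2 d → ℝ≥0∞) :
    ∫⁻ ω, f ω ∂Phat = ∑' u : {u : List ℕ // u.length = n},
      ∫⁻ ω in {ω | spineTake ω.2 n = u}, f ω ∂Phat := by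
  have h := lintegral_iUnion (μ := Phat)
    (fun u : {u : List ℕ // u.length = n} => measurableSet_spineTake_snd (d := d) n u.1)
    (disjoint_spineTake n) f
  rwa [iUnion_spineTake, Measure.restrict_univ] at h

include hH hB in
-- The events `{w|n = z}` with `|z| = n` partition the space, and the weights of these `z` add up to
-- `M_n`.
theorem HasSpineDensity.isSizeBiased {Phat : Measure (Omega2 d)} [IsProbabilityMeasure Phat]
    (hP : HasSpineDensity η H B x b Phat) : IsSizeBiased η H B x b (Phat.map Prod.fst) := by
  refine ⟨Measure.isProbabilityMeasure_map measurable_fst.aemeasurable, fun n A hA => ?_⟩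
  have hA' : MeasurableSet A := filtF_le _ _ hA
  have hfA : MeasurableSet (Prod.fst ⁻¹' A : Set (Omega2 d)) := measurable_fst hA'
  rw [Measure.map_apply measurable_fst hA', ← lintegral_indicator_one hfA,
    lintegral_eq_tsum_spineTake Phat n]
  unfold martM
  rw [lintegral_tsum fun u : {u : List ℕ // u.length = n} =>
    (measurable_nodeTerm hH hB u.1).aemeasurable]
  simp only [div_eq_mul_inv]
  rw [← ENNReal.tsum_mul_right]
  refine tsum_congr fun u => ?_
  obtain ⟨z, rfl⟩ := u
  rw [lintegral_indicator_one hfA, Measure.restrict_apply hfA, hP z A hA, div_eq_mul_inv]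

include hH hB in
theorem HasSpineDensity.isSizeBiasedWithSpine {Phat : Measure (Omega2 d)}
    [IsProbabilityMeasure Phat] (hP : HasSpineDensity η H B x b Phat) :
    IsSizeBiasedWithSpine η H B x b Phat := by
  have hsb := hP.isSizeBiased hH hB
  refine ⟨inferInstance, hsb, ?_⟩
  rintro _ z rfl
  have hs := measurableSet_spineTake_snd (d := d) z.length z
  have hint : Integrable (fun ω : Omega2 d => (nodeTerm H B ω.1 z / martM H B z.length ω.1).toReal)
      Phat := by
    refine Integrable.of_bound (C := 1)
      ((measurable_ratio hH hB z).comp measurable_fst).ennreal_toReal.aestronglyMeasurable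
      (Filter.Eventually.of_forall fun ω => ?_)
    rw [Real.norm_of_nonneg ENNReal.toReal_nonneg]
    exact ENNReal.toReal_le_of_le_ofReal zero_le_one
      (by rw [ENNReal.ofReal_one]; exact nodeTerm_div_martM_le_one ω.1 z)
  refine (ae_eq_condExp_of_forall_setIntegral_eq (comap_filtF_le z.length)
    ((integrable_const (1 : ℝ)).indicator hs) (fun _ _ _ => hint.integrableOn) ?_ ?_).symm
  · rintro _ ⟨A, hA, rfl⟩ -
    rw [setIntegral_ratio hH hB hsb z hA, setIntegral_indicator hs, setIntegral_const,
      smul_eq_mul, mul_one, Measure.real, hP z A hA]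
  · exact ((measurable_ratio_comap hH hB z).ennreal_toReal).aestronglyMeasurable

include hH hB in
theorem HasSpineDensity.setLIntegral_eq {Phat : Measure (Omega2 d)}
    (hP : HasSpineDensity η H B x b Phat) (z : List ℕ) {φ : Omega1 d → ℝ≥0∞}
    (hφ : Measurable[filtF d z.length] φ) :
    ∫⁻ ω in {ω | spineTake ω.2 z.length = z}, φ ω.1 ∂Phat =
      (∫⁻ ω, nodeTerm H B ω z * φ ω ∂lawP η x b) / ENNReal.ofReal (H (x, b)) := by
  have hφ' := hφ.mono (filtF_le z.length) le_rfl
  have hM := measurable_nodeTerm (d := d) hH hB z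
  rw [← lintegral_map hφ' measurable_fst, lintegral_eq_of_eq_on_measurableSet (filtF_le z.length)
    (ν := (ENNReal.ofReal (H (x, b)))⁻¹ • (lawP η x b).withDensity fun ω => nodeTerm H B ω z) ?_ hφ,
    lintegral_smul_measure, lintegral_withDensity_eq_lintegral_mul _ hM hφ',
    smul_eq_mul, ENNReal.div_eq_inv_mul]
  · rfl
  · intro A hA
    have hA' := filtF_le _ _ hA
    rw [Measure.map_apply measurable_fst hA', Measure.restrict_apply (measurable_fst hA'),
      hP z A hA, Measure.smul_apply, withDensity_apply _ hA', smul_eq_mul, ENNReal.div_eq_inv_mul]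

/-! ## Uniqueness -/

theorem eq_on_filtFinf {μ ν : Measure (Omega1 d)} [IsProbabilityMeasure μ]
    [IsProbabilityMeasure ν] (h : ∀ n A, MeasurableSet[filtF d n] A → μ A = ν A)
    {A : Set (Omega1 d)} (hA : MeasurableSet[filtFinf d] A) : μ A = ν A := by
  have hle : filtFinf d ≤ (inferInstance : MeasurableSpace (Omega1 d)) := iSup_le filtF_le
  have hgen : filtFinf d = MeasurableSpace.generateFrom
      (⋃ n, {s | MeasurableSet[filtF d n] s}) :=
    (MeasurableSpace.generateFrom_iUnion_measurableSet (filtF d)).symm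
  have hpi : IsPiSystem (⋃ n, {s | MeasurableSet[filtF d n] s}) :=
    isPiSystem_iUnion_of_monotone _ (fun n => @MeasurableSpace.isPiSystem_measurableSet _ (filtF d n))
      fun m n hmn s hs => filtF_mono hmn s hs
  have : μ.trim hle = ν.trim hle := by
    have := isFiniteMeasure_trim (μ := μ) hle
    refine @ext_of_generate_finite _ (filtFinf d) _ _ _ hgen hpi _ ?_ ?_
    · intro s hs
      obtain ⟨n, hn⟩ := Set.mem_iUnion.1 hs
      have hs' : MeasurableSet[filtFinf d] s := le_iSup (filtF d) n s hn
      rw [trim_measurableSet_eq hle hs', trim_measurableSet_eq hle hs', h n s hn]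
    · rw [trim_measurableSet_eq hle .univ, trim_measurableSet_eq hle .univ, measure_univ,
        measure_univ]
  rw [← trim_measurableSet_eq hle hA, this, trim_measurableSet_eq hle hA]

/-- The events that are determined by `ℱ_n` and the first `n` letters of the spine. -/
def spineCylinders (d : ℕ) : Set (Set (Omega2 d)) :=
  {E | ∃ (z : List ℕ) (A : Set (Omega1 d)), MeasurableSet[filtF d z.length] A ∧
    E = Prod.fst ⁻¹' A ∩ {ω | spineTake ω.2 z.length = z}}

/-- Of two words, either the longer one extends the shorter one, and the longer word describes the
intersection, or the two spine events are disjoint. -/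
theorem isPiSystem_spineCylinders : IsPiSystem (spineCylinders d) := by
  have key : ∀ (z z' : List ℕ) (A A' : Set (Omega1 d)), z.length ≤ z'.length →
      MeasurableSet[filtF d z.length] A → MeasurableSet[filtF d z'.length] A' →
      (Prod.fst ⁻¹' A ∩ {ω : Omega2 d | spineTake ω.2 z.length = z}) ∩
        (Prod.fst ⁻¹' A' ∩ {ω : Omega2 d | spineTake ω.2 z'.length = z'}) ∈ spineCylinders d := by
    intro z z' A A' hle hA hA'
    by_cases hz : z'.take z.length = z
    · refine ⟨z', A ∩ A', MeasurableSet.inter (filtF_mono hle _ hA) hA', ?_⟩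
      ext ω
      constructor
      · rintro ⟨⟨h1, h2⟩, h3, h4⟩
        exact ⟨⟨h1, h3⟩, h4⟩
      · rintro ⟨⟨h1, h3⟩, h4⟩
        refine ⟨⟨h1, ?_⟩, h3, h4⟩
        have h4' : spineTake ω.2 z'.length = z' := h4
        change spineTake ω.2 z.length = z
        rw [← take_spineTake _ hle, h4', hz]
    · refine ⟨z', ∅, @MeasurableSet.empty _ (filtF d z'.length), ?_⟩
      ext ω
      constructor
      · rintro ⟨⟨-, h2⟩, -, h4⟩
        have h2' : spineTake ω.2 z.length = z := h2
        have h4' : spineTake ω.2 z'.length = z' := h4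
        rw [← take_spineTake _ hle, h4'] at h2'
        exact absurd h2' hz
      · rintro ⟨h, -⟩
        exact absurd h (Set.notMem_empty _)
  rintro _ ⟨z, A, hA, rfl⟩ _ ⟨z', A', hA', rfl⟩ -
  rcases le_total z.length z'.length with hle | hle
  · exact key z z' A A' hle hA hA'
  · rw [Set.inter_comm]
    exact key z' z A' A hle hA' hA

theorem spineCylinders_measurableSet {E : Set (Omega2 d)} (hE : E ∈ spineCylinders d) :
    MeasurableSet E := by
  obtain ⟨z, A, hA, rfl⟩ := hE
  exact (measurable_fst (filtF_le _ _ hA)).inter (measurableSet_spineTake_snd _ _)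

theorem filtSpineInf_le_generateFrom :
    filtSpineInf d ≤ MeasurableSpace.generateFrom (spineCylinders d) := by
  have hcyl : ∀ (z : List ℕ) (A : Set (Omega1 d)), MeasurableSet[filtF d z.length] A →
      MeasurableSet[MeasurableSpace.generateFrom (spineCylinders d)]
        (Prod.fst ⁻¹' A ∩ {ω | spineTake ω.2 z.length = z}) := fun z A hA =>
    MeasurableSpace.measurableSet_generateFrom ⟨z, A, hA, rfl⟩
  refine sup_le ?_ ?_
  · rw [filtFinf, MeasurableSpace.comap_iSup]
    refine iSup_le fun n => ?_
    rintro _ ⟨A, hA, rfl⟩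
    -- An event of `ℱ_n` is the countable union of its intersections with the events `{w|n = z}`.
    rw [← Set.inter_univ (Prod.fst ⁻¹' A), ← iUnion_spineTake n, Set.inter_iUnion]
    refine MeasurableSet.iUnion fun u => ?_
    obtain ⟨z, rfl⟩ := u
    exact hcyl z A hA
  · refine Measurable.comap_le (@measurable_pi_lambda _ _ _
      (MeasurableSpace.generateFrom (spineCylinders d)) _ _ fun k => ?_)
    refine @measurable_to_countable' _ _ _ _ (MeasurableSpace.generateFrom (spineCylinders d)) _ ?_
    intro m
    have : (fun ω : Omega2 d => ω.2 k) ⁻¹' {m} =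
        ⋃ u : {z : List ℕ // z.length = k}, {ω | spineTake ω.2 (k + 1) = u.1 ++ [m]} := by
      ext ω
      simp only [Set.mem_iUnion]
      constructor
      · intro h
        refine ⟨⟨spineTake ω.2 k, length_spineTake _ _⟩, ?_⟩
        have h' : ω.2 k = m := h
        change spineTake ω.2 (k + 1) = spineTake ω.2 k ++ [m]
        rw [spineTake_succ, h']
      · rintro ⟨u, hu⟩
        have hu' : spineTake ω.2 (k + 1) = u.1 ++ [m] := hu
        rw [spineTake_succ] at hu'
        exact (List.append_singleton_inj.1 hu').2
    rw [this]
    refine MeasurableSet.iUnion fun u => ?_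
    have := hcyl (u.1 ++ [m]) Set.univ MeasurableSet.univ
    simpa [u.2] using this

theorem HasSpineDensity.eq_on_filtSpineInf {μ ν : Measure (Omega2 d)} [IsProbabilityMeasure μ]
    [IsProbabilityMeasure ν] (hμ : HasSpineDensity η H B x b μ)
    (hν : HasSpineDensity η H B x b ν) {A : Set (Omega2 d)}
    (hA : MeasurableSet[filtSpineInf d] A) : μ A = ν A := by
  have hle : MeasurableSpace.generateFrom (spineCylinders d) ≤
      (inferInstance : MeasurableSpace (Omega2 d)) :=
    MeasurableSpace.generateFrom_le fun E hE => spineCylinders_measurableSet hE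
  have : μ.trim hle = ν.trim hle := by
    have := isFiniteMeasure_trim (μ := μ) hle
    refine @ext_of_generate_finite _ (MeasurableSpace.generateFrom (spineCylinders d)) _ _ _ rfl
      isPiSystem_spineCylinders _ ?_ ?_
    · intro E hE
      have hE' := MeasurableSpace.measurableSet_generateFrom hE
      obtain ⟨z, A, hA, rfl⟩ := hE
      rw [trim_measurableSet_eq hle hE', trim_measurableSet_eq hle hE', hμ z A hA, hν z A hA]
    · rw [trim_measurableSet_eq hle .univ, trim_measurableSet_eq hle .univ, measure_univ,
        measure_univ]
  have hA' := filtSpineInf_le_generateFrom A hA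
  rw [← trim_measurableSet_eq hle hA', this, trim_measurableSet_eq hle hA']

end Characterization

/-! ## The path along the spine -/

/-- Meant for evaluating `(X_u, S_u)` at the random node `u = w|n`, which has countably many values.
-/
theorem measurable_apply_index {Ω Ω' E ι : Type*} [MeasurableSpace Ω] [MeasurableSpace Ω']
    [MeasurableSpace E] [Countable ι] {g : ι → Ω → E} (hg : ∀ i, Measurable (g i)) {t : Ω' → ι}
    (ht : ∀ i, MeasurableSet {w | t w = i}) : Measurable fun q : Ω × Ω' => g (t q.2) q.1 := by
  let _ : MeasurableSpace ι := ⊤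
  have h : Measurable fun q : Ω × ι => g q.2 q.1 := measurable_from_prod_countable_left hg
  have h' : Measurable t := measurable_to_countable' ht
  exact h.comp (measurable_fst.prodMk (h'.comp measurable_snd))

theorem measurable_spineWalk {d : ℕ} : Measurable (spineWalk (d := d)) := by
  refine measurable_pi_lambda _ fun n => ?_
  simp only [spineWalk]
  exact measurable_apply_index (g := fun (z : List ℕ) (ω : Omega1 d) => (X ω z, S ω z))
    (t := fun w => spineTake w n) measurable_node (measurableSet_spineTake_eq n)

section SpinePath

variable {d : ℕ} (η : Measure (Config d)) [IsProbabilityMeasure η] {α : ℝ} {r : Sph d → ℝ}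
  {B : Set ℝ} {x : Sph d} {b : ℝ}

omit [IsProbabilityMeasure η] in
theorem HasSpineDensity.lintegral_spineWalk {H : Sph d × ℝ → ℝ} (hH : Measurable H)
    (hB : MeasurableSet B) {Phat : Measure (Omega2 d)} (hP : HasSpineDensity η H B x b Phat)
    (n : ℕ) {f : (Fin (n + 1) → Sph d × ℝ) → ℝ≥0∞} (hf : Measurable f) :
    ∫⁻ ω, f (fun k => spineWalk ω k) ∂Phat =
      ∑' u : {u : List ℕ // u.length = n}, (∫⁻ ω, nodeTerm H B ω u *
        f (fun k => walk (ω.2, branchPath ω.1 u) k) ∂lawP η x b) / ENNReal.ofReal (H (x, b)) := by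
  rw [lintegral_eq_tsum_spineTake Phat n]
  refine tsum_congr fun u => ?_
  obtain ⟨z, rfl⟩ := u
  have hs := measurableSet_spineTake_snd (d := d) z.length z
  have hφ : Measurable[filtF d z.length] fun ω : Omega1 d =>
      f (fun k => walk (ω.2, treePath ω.1 z) k) :=
    hf.comp (@measurable_pi_lambda _ _ _ (filtF d z.length) _ _ fun k =>
      measurable_treeWalk_filtF le_rfl k)
  -- The weight of `z` vanishes off the tree, so the spine almost surely stays in the tree; there
  -- `treePath`, which is `ℱ_n`-measurable, may replace `branchPath`.
  have hnull : Phat (Prod.fst ⁻¹' {ω : Omega1 d | InTree ω.1 z}ᶜ ∩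
      {ω | spineTake ω.2 z.length = z}) = 0 := by
    have hm : MeasurableSet[filtF d z.length] {ω : Omega1 d | InTree ω.1 z} :=
      measurableSet_inTree_filtF le_rfl
    rw [hP z _ hm.compl, setLIntegral_congr_fun (g := fun _ => 0)
      ((filtF_le _ _ hm).compl), lintegral_zero, ENNReal.zero_div]
    intro ω hω
    exact if_neg fun h => hω h.1
  have hae : ∀ᵐ ω ∂Phat.restrict {ω | spineTake ω.2 z.length = z}, InTree ω.1.1 z := by
    rw [ae_restrict_iff' hs, ae_iff]
    refine measure_mono_null (fun ω hω => ?_) hnull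
    have hω' : ¬ (spineTake ω.2 z.length = z → InTree ω.1.1 z) := hω
    rw [Classical.not_imp] at hω'
    exact ⟨hω'.2, hω'.1⟩
  calc _ = ∫⁻ ω in {ω | spineTake ω.2 z.length = z},
        f (fun k => walk (ω.1.2, treePath ω.1.1 z) k) ∂Phat := by
        refine lintegral_congr_ae ?_
        filter_upwards [hae, ae_restrict_mem hs] with ω h1 h2
        have h2' : spineTake ω.2 z.length = z := h2
        congr 1
        ext1 k
        have hk : (k : ℕ) ≤ z.length := Nat.lt_succ_iff.1 k.2
        rw [treePath_eq h1, ← node_take_eq_walk ω.1 z hk, spineWalk, ← take_spineTake ω.2 hk, h2']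
    _ = _ := by
        rw [hP.setLIntegral_eq hH hB z hφ]
        congr 1
        refine lintegral_congr fun ω => ?_
        by_cases h : InTree ω.1 z
        · rw [treePath_eq h]
        · have : nodeTerm H B ω z = 0 := if_neg fun h' => h h'.1
          simp [this]

/-- The law of the positions along the spine as an `h`-transform of the walk. -/
theorem HasSpineDensity.lintegral_spineWalk_eq (hr_meas : Measurable r) (hr_pos : ∀ x, 0 < r x)
    (hr : ∀ x, transferOp η α r x = r x) (hB : MeasurableSet B) {h : Sph d × ℝ → ℝ}
    (hh : IsPositiveHarmonic η α r B h) (hb : b ∈ B) {Phat : Measure (Omega2 d)}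
    (hP : HasSpineDensity η (Halpha α r h) B x b Phat)
    (n : ℕ) {f : (Fin (n + 1) → Sph d × ℝ) → ℝ≥0∞} (hf : Measurable f) :
    ∫⁻ ω, f (fun k => spineWalk ω k) ∂Phat =
      ∫⁻ q in {q | ∀ k ≤ n, (walk q k).2 ∈ B}, f (fun k => walk q k) *
        ENNReal.ofReal (h (walk q n) / h (x, b)) ∂(lawQ η α r x b) := by
  classical
  have hH := measurable_Halpha (α := α) hr_meas hh.1
  have hH1 : Measurable (Halpha α r fun _ : Sph d × ℝ => 1) :=
    measurable_Halpha hr_meas measurable_const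
  have hset : MeasurableSet {q : (Sph d × ℝ) × (ℕ → Mat d) | ∀ k ≤ n, (walk q k).2 ∈ B} := by
    simp only [Set.ofPred_forall]
    exact MeasurableSet.iInter fun k => MeasurableSet.iInter fun _ => (measurable_walk k).snd hB
  have hpath : Measurable fun q : (Sph d × ℝ) × (ℕ → Mat d) =>
      f (fun k : Fin (n + 1) => walk q k) :=
    hf.comp (measurable_pi_lambda _ fun k => measurable_walk k)
  have hG : Measurable ({q : (Sph d × ℝ) × (ℕ → Mat d) | ∀ k ≤ n, (walk q k).2 ∈ B}.indicator
      fun q => f (fun k : Fin (n + 1) => walk q k) *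
        ENNReal.ofReal (h (walk q n) / h (x, b))) :=
    (hpath.mul ((hh.1.comp (measurable_walk n)).div_const _).ennreal_ofReal).indicator hset
  rw [← lintegral_indicator hset, lintegral_lawQ η x b hG]
  set Ψ := {q : (Sph d × ℝ) × (ℕ → Mat d) | ∀ k ≤ n, (walk q k).2 ∈ B}.indicator
      fun q => f (fun k : Fin (n + 1) => walk q k) *
        ENNReal.ofReal (h (walk q n) / h (x, b)) with hΨ
  have hΨm : Measurable fun a => Ψ ((x, b), a) := hG.comp measurable_prodMk_left
  rw [lintegral_matLaw_eq_tsum η hr_meas hr_pos hr (x, b) n hΨm, hP.lintegral_spineWalk η hH hB n hf,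
    ← ENNReal.tsum_mul_left]
  swap
  -- The positions up to time `n` use only the first `n` matrices, so the many-to-one formula
  -- applies at level `n`.
  · intro a a' haa
    have hw : ∀ k ≤ n, walk ((x, b), a) k = walk ((x, b), a') k := fun k hk =>
      walk_congr fun i hi => haa i (by omega)
    have hw' : (fun k : Fin (n + 1) => walk ((x, b), a) k) =
        fun k : Fin (n + 1) => walk ((x, b), a') k :=
      funext fun k => hw k (Nat.lt_succ_iff.1 k.2)
    have hmem : ((x, b), a) ∈ {q : (Sph d × ℝ) × (ℕ → Mat d) | ∀ k ≤ n, (walk q k).2 ∈ B} ↔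
        ((x, b), a') ∈ {q : (Sph d × ℝ) × (ℕ → Mat d) | ∀ k ≤ n, (walk q k).2 ∈ B} :=
      forall_congr' fun k => forall_congr' fun hk => by rw [hw k hk]
    simp only [hΨ, Set.indicator_apply, hmem, hw', hw n le_rfl]
  refine tsum_congr fun u => ?_
  obtain ⟨z, rfl⟩ := u
  have hm : Measurable fun ω : Omega1 d => nodeTerm (Halpha α r h) B ω z *
      f (fun k : Fin (z.length + 1) => walk (ω.2, branchPath ω.1 z) k) :=
    (measurable_nodeTerm hH hB z).mul (hpath.comp
      (measurable_snd.prodMk ((measurable_branchPath z).comp measurable_fst)))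
  have hm' : Measurable fun ω : Env d => nodeTerm (Halpha α r h) B (ω, (x, b)) z *
      f (fun k : Fin (z.length + 1) => walk ((x, b), branchPath ω z) k) :=
    hm.comp measurable_prodMk_right
  rw [lintegral_lawP η x b hm, div_eq_mul_inv, ← lintegral_mul_const _ hm', ← lintegral_const_mul]
  swap
  · exact ((measurable_nodeTerm hH1 MeasurableSet.univ z).comp measurable_prodMk_right).mul
      (hΨm.comp (measurable_branchPath z))
  refine lintegral_congr fun ω => ?_
  have hal := alive_iff_walk B (ω, (x, b)) z
  by_cases hT : InTree ω z
  · by_cases hS : ∀ k ≤ z.length, (walk ((x, b), branchPath ω z) k).2 ∈ B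
    · have h1 : Alive B (ω, (x, b)) z := hal.2 ⟨hT, hS⟩
      have h2 : Alive Set.univ (ω, (x, b)) z := ⟨hT, fun _ _ => Set.mem_univ _⟩
      have hw := node_eq_walk (ω, (x, b)) z
      rw [hΨ, Set.indicator_of_mem (by exact hS), nodeTerm_eq, nodeTerm_eq, if_pos h1, if_pos h2, hw]
      have hSn := hS z.length le_rfl
      simp only
      generalize walk ((x, b), branchPath ω z) z.length = q at hSn ⊢
      have e1 := hr_pos x
      have e2 := (hh.2 x b hb).1
      have e3 := hr_pos q.1
      have e4 := (hh.2 q.1 q.2 hSn).1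
      have e5 : 0 < Halpha α r h (x, b) := by simp only [Halpha]; positivity
      have e6 : 0 < Halpha α r (fun _ => 1) (x, b) := by simp only [Halpha]; positivity
      have e7 : 0 < Halpha α r h q := by simp only [Halpha]; positivity
      have e8 : 0 < Halpha α r (fun _ => 1) q := by simp only [Halpha]; positivity
      rw [← ENNReal.ofReal_inv_of_pos e5, ← ENNReal.ofReal_inv_of_pos e6]
      -- The weights with `h` and with `1` differ by the factor `h`, so their normalized versions
      -- differ by `h(q) / h(x,b)`.
      have key : ENNReal.ofReal (Halpha α r h q) * ENNReal.ofReal (Halpha α r h (x, b))⁻¹ =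
          ENNReal.ofReal (Halpha α r (fun _ => 1) (x, b))⁻¹ *
            ENNReal.ofReal (Halpha α r (fun _ => 1) q) * ENNReal.ofReal (h q / h (x, b)) := by
        rw [← ENNReal.ofReal_mul e7.le, ← ENNReal.ofReal_mul (inv_pos.2 e6).le,
          ← ENNReal.ofReal_mul (mul_pos (inv_pos.2 e6) e8).le]
        congr 1
        simp only [Halpha]
        field_simp
      rw [mul_right_comm, key]
      ring
    · have h1 : ¬ Alive B (ω, (x, b)) z := fun h => hS (hal.1 h).2
      rw [hΨ, Set.indicator_of_notMem (by exact hS), nodeTerm_eq, if_neg h1]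
      simp
  · have h1 : ¬ Alive B (ω, (x, b)) z := fun h => hT h.1
    have h2 : ¬ Alive Set.univ (ω, (x, b)) z := fun h => hT h.1
    rw [nodeTerm_eq, nodeTerm_eq, if_neg h1, if_neg h2]
    simp

theorem hasSpineDensity_lawSpine (hr_meas : Measurable r) (hr_pos : ∀ x, 0 < r x)
    (hr : ∀ x, transferOp η α r x = r x) (hB : MeasurableSet B) {h : Sph d × ℝ → ℝ}
    (hh : IsPositiveHarmonic η α r B h) (hb : b ∈ B) :
    HasSpineDensity η (Halpha α r h) B x b (lawSpine η (Halpha α r h) B x b) := by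
  intro z A hA
  refine lawSpine_apply η (measurable_Halpha hr_meas hh.1) hB (fun p hp => ⟨?_, ?_⟩) hb z hA
  · exact mul_pos (mul_pos (hr_pos _) (hh.2 p.1 p.2 hp).1) (Real.exp_pos _)
  · exact lintegral_totalWeight_Halpha η hr_meas hr_pos hr hB hh p hp

/-- Nothing is killed when `B = ℝ`, so this is the statement that `lawQ` has mass one. -/
theorem isPositiveHarmonic_one : IsPositiveHarmonic η α r Set.univ fun _ => 1 := by
  refine ⟨measurable_const, fun x b _ => ⟨one_pos, ?_⟩⟩
  simp

/-- A law on sequences is determined by the laws of the initial segments. -/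
theorem ext_of_lintegral_initial {E : Type*} [MeasurableSpace E] {μ ν : Measure (ℕ → E)}
    [IsFiniteMeasure μ] [IsFiniteMeasure ν]
    (h : ∀ (n : ℕ) (f : (Fin (n + 1) → E) → ℝ≥0∞), Measurable f →
      ∫⁻ y, f (fun k => y k) ∂μ = ∫⁻ y, f (fun k => y k) ∂ν) : μ = ν := by
  have : ∀ I : Finset ℕ, IsFiniteMeasure (μ.map I.restrict) := fun I => inferInstance
  refine IsProjectiveLimit.unique (P := fun I : Finset ℕ => μ.map I.restrict) (fun I => rfl)
    fun I => ?_
  ext s hs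
  have hr := Finset.measurable_restrict (X := fun _ : ℕ => E) I
  rw [Measure.map_apply hr hs, Measure.map_apply hr hs, ← lintegral_indicator_one (hr hs),
    ← lintegral_indicator_one (hr hs)]
  -- Any finite set of times lies in an initial segment, which reduces its marginal to the
  -- hypothesis.
  have hle : ∀ i : I, (i : ℕ) < I.sup id + 1 := fun i =>
    Nat.lt_succ_iff.2 (Finset.le_sup (f := id) i.2)
  have hm : Measurable fun v : Fin (I.sup id + 1) → E => fun i : I => v ⟨i, hle i⟩ := by fun_prop
  exact (h (I.sup id) (fun v => s.indicator 1 fun i : I => v ⟨i, hle i⟩)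
    ((measurable_one.indicator hs).comp hm)).symm

theorem HasSpineDensity.map_spineWalk (hr_meas : Measurable r) (hr_pos : ∀ x, 0 < r x)
    (hr : ∀ x, transferOp η α r x = r x) {Phat : Measure (Omega2 d)} [IsProbabilityMeasure Phat]
    (hP : HasSpineDensity η (Halpha α r fun _ => 1) Set.univ x b Phat) :
    Phat.map spineWalk = (lawQ η α r x b).map walk := by
  have hw : Measurable (walk (d := d)) := measurable_pi_lambda _ measurable_walk
  refine ext_of_lintegral_initial fun n f hf => ?_
  have hf' : Measurable fun y : ℕ → Sph d × ℝ => f fun k => y k := by fun_prop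
  rw [lintegral_map hf' measurable_spineWalk, lintegral_map hf' hw,
    hP.lintegral_spineWalk_eq η hr_meas hr_pos hr MeasurableSet.univ
      (isPositiveHarmonic_one η) (Set.mem_univ b) n hf]
  simp

end SpinePath

end MatrixBRW

/-! ### The spinal decomposition theorem -/

open MatrixBRW
theorem mainTheorem4 {d : ℕ} (η : Measure (Config d)) [IsProbabilityMeasure η]
    (hpos : ∃ g ∈ semigroupΓ η, ∀ i j, 0 < g.1 i j)
    (hN : 1 < ∫⁻ c, (c.1 : ℝ≥0∞) ∂η)
    (α : ℝ) (hα : α ∈ interior (momentSet η)) (hm : IsDominantEigenvalue η α 1)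
    (r : Sph d → ℝ) (hr_cont : Continuous r) (hr_pos : ∀ x, 0 < r x)
    (hr : ∀ x, transferOp η α r x = r x) :
    -- the law `ℚ_{x,b}^α` is the projective limit of its defining finite-dimensional laws, with
    -- density `e^{αb} / r(x) · ∑_{|u|=n} e^{-α S_u} r(X_u)` on the branches `(g_{u|1}, …, g_{u|n})`
    (∀ (x : Sph d) (b : ℝ), IsProbabilityMeasure (lawQ η α r x b) ∧
      (∀ᵐ q ∂(lawQ η α r x b), q.1 = (x, b)) ∧
      ∀ (n : ℕ) (f : (Fin n → Mat d) → ℝ≥0∞), Measurable f →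
        ∫⁻ q, f (fun i => q.2 i) ∂(lawQ η α r x b) =
          ENNReal.ofReal (Real.exp (α * b) / r x) *
            ∫⁻ ω, ∑' u : {u : List ℕ // u.length = n},
              nodeTerm (Halpha α r fun _ => 1) Set.univ ω u *
                f (fun i => gMat ω.1 (u.1.take (i + 1))) ∂(lawP η x b)) ∧
    -- the general result, for a set `B` and a positive harmonic function `h`
    (∀ (B : Set ℝ) (h : Sph d × ℝ → ℝ), MeasurableSet B → IsPositiveHarmonic η α r B h →
      ∀ (x : Sph d), ∀ b ∈ B,
        -- the process constructed from the spine has the size-biased law and the given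
        -- conditional law of the spine
        IsSizeBiasedWithSpine η (Halpha α r h) B x b (lawSpine η (Halpha α r h) B x b) ∧
        -- these properties determine the law
        (∀ Phat : Measure (Omega1 d), IsSizeBiased η (Halpha α r h) B x b Phat →
          ∀ A, MeasurableSet[filtFinf d] A →
            lawSpine η (Halpha α r h) B x b (Prod.fst ⁻¹' A) = Phat A) ∧
        (∀ Phat : Measure (Omega2 d), IsSizeBiasedWithSpine η (Halpha α r h) B x b Phat →
          (∀ A, MeasurableSet[filtSpineInf d] A →
            lawSpine η (Halpha α r h) B x b A = Phat A) ∧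
          -- the law of the path along the spine
          ∀ (n : ℕ) (f : (Fin (n + 1) → Sph d × ℝ) → ℝ≥0∞), Measurable f →
            ∫⁻ ω, f (fun k => spineWalk ω k) ∂Phat =
              ∫⁻ q in {q | ∀ k ≤ n, (walk q k).2 ∈ B}, f (fun k => walk q k) *
                ENNReal.ofReal (h (walk q n) / h (x, b)) ∂(lawQ η α r x b))) ∧
    -- the untruncated case `B = ℝ`, `h = 1`
    (∀ (x : Sph d) (b : ℝ),
      IsSizeBiasedWithSpine η (Halpha α r fun _ => 1) Set.univ x b
        (lawSpine η (Halpha α r fun _ => 1) Set.univ x b) ∧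
      ∀ Phat : Measure (Omega2 d),
        IsSizeBiasedWithSpine η (Halpha α r fun _ => 1) Set.univ x b Phat →
          Phat.map spineWalk = (lawQ η α r x b).map walk) := by

  have hr_meas : Measurable r := hr_cont.measurable
  refine ⟨fun x b => ⟨inferInstance, ae_lawQ_fst η x b, fun n f hf =>
    lintegral_lawQ_eq η hr_meas hr_pos hr x b n hf⟩, ?_, ?_⟩
  · intro B h hB hh x b hb
    have hH := measurable_Halpha (α := α) hr_meas hh.1
    have hS := hasSpineDensity_lawSpine η (x := x) hr_meas hr_pos hr hB hh hb
    have hS' := hS.isSizeBiasedWithSpine hH hB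
    refine ⟨hS', fun Phat hP A hA => ?_, fun Phat hP => ?_⟩
    · have := hP.1
      have := hS'.2.1.1
      have hA' : MeasurableSet A := iSup_le filtF_le A hA
      rw [← Measure.map_apply measurable_fst hA']
      exact eq_on_filtFinf (fun n A hA => (hS'.2.1.2 n A hA).trans (hP.2 n A hA).symm) hA
    · have := hP.1
      -- Any other extension has the same joint density, which fixes the law on `σ(ℱ_∞, w)` and the
      -- law of the spine path.
      have hP' := hP.hasSpineDensity hH hB
      exact ⟨fun A hA => hS.eq_on_filtSpineInf hP' hA, fun n f hf =>
        hP'.lintegral_spineWalk_eq η hr_meas hr_pos hr hB hh hb n hf⟩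
  · intro x b
    have hH := measurable_Halpha (α := α) hr_meas (measurable_const (a := (1 : ℝ)))
    have hS := hasSpineDensity_lawSpine η (x := x) hr_meas hr_pos hr MeasurableSet.univ
      (isPositiveHarmonic_one η) (Set.mem_univ b)
    refine ⟨hS.isSizeBiasedWithSpine hH MeasurableSet.univ, fun Phat hP => ?_⟩
    have := hP.1
    exact (hP.hasSpineDensity hH MeasurableSet.univ).map_spineWalk η hr_meas hr_pos hr
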